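/- Fix integers $s\ge 0$ and $n\ge 1$. Spaces are compactly generated weak Hausdorff. **The space $ku_n$.** For a finite dimensional complex inner product space $V$ let $L(V,W)$ be the space of linear isometric embeddings $V\hookrightarrow W$, with the Stiefel topology if $\dim W<\infty$ and with the colimit topology over the finite dimensional subspaces of $W$ if $W$ has countably infinite dimension. Let $\mathcal U=\mathrm{Sym}(\mathbb C^n)$ be the symmetric algebra, with the inner product for which different degrees are orthogonal and $\langle v_1\cdots v_d,w_1\cdots w_d\rangle=\sum_{\tau\in\Sigma_d}\prod_i\langle v_i,w_{\tau(i)}\rangle$. For $\langle k\rangle=\{0,1,\dots,k\}$ with basepoint $0$ let $$ku(\langle k\rangle,\mathcal U)=\bigsqcup_{m_1,\dots,m_k\ge 0}L(\mathbb C^{m_1}\oplus\cdots\oplus\mathbb C^{m_k},\mathcal U)/(U(m_1)\times\cdots\times U(m_k)),$$ the space of $k$-tuples of mutually orthogonal finite dimensional subspaces of $\mathcal U$; a based map $\alpha\colon\langle k\rangle\to\langle l\rangle$ sends $(V_j)_j$ to $(\bigoplus_{\alpha(j)=i}V_j)_i$. Let $S^n=(\mathbb R^n)^+$ be the one-point compactification,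 with basepoint $\infty$, and let $$ku_n=ku(S^n,\mathcal U)=\int^{\langle k\rangle}ku(\langle k\rangle,\mathcal U)\times\mathrm{Map}_*(\langle k\rangle,S^n)$$ be the coend over the finite based sets $\langle k\rangle$. Its points are classes $[(V_1,x_1),\dots,(V_k,x_k)]$. For $\sigma\in\Sigma_n$ let $\sigma_*$ be the isometry of $\mathcal U$ induced by $e_i\mapsto e_{\sigma(i)}$, let $\Sigma_n$ act on $S^n$ by permuting the coordinates of $\mathbb R^n$ in the same way, and on $ku_n$ by $\sigma\cdot[(V_i,x_i)_i]=[(\sigma_*(V_i),\sigma\cdot x_i)_i]$. **The rank filtration.** For $s\ge -1$ let $R^s(ku_n)\subseteq ku_n$ be the subspace of all $[(V_1,x_1),\dots,(V_k,x_k)]$ with $\sum_{x_i\ne\infty}\dim_{\mathbb C}V_i\le s$. The action of $\Sigma_n$ restricts to $R^s(ku_n)$. A quotient $A/B$ is the pointed space obtained from $A$ by collapsing $B$ to the basepoint, with $A/\emptyset=A_+$ ($A$ with a disjoint basepoint). **The commuting variety.** Let $C_n(\mathfrak u_s)$ be the space of $n$-tuples of pairwise commuting skew-Hermitian complex $s\times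 s$ matrices, with the Euclidean topology, and $C_n(\mathfrak u_s)^+$ its one-point compactification. The group $U(s)$ acts on it by simultaneous conjugation, fixing the added point, and on $L(\mathbb C^s,\mathcal U)$ by precomposition. Let $C_n(\mathfrak u_s)^+\wedge_{U(s)}L(\mathbb C^s,\mathcal U)_+$ be the quotient of the smash product $C_n(\mathfrak u_s)^+\wedge L(\mathbb C^s,\mathcal U)_+$ by the relation $gX\wedge f\sim X\wedge(f\circ g)$, $g\in U(s)$. The group $\Sigma_n$ acts on it by $$\sigma\cdot[(X_1,\dots,X_n)\wedge f]=[(X_{\sigma^{-1}(1)},\dots,X_{\sigma^{-1}(n)})\wedge(\sigma_*\circ f)].$$ **Theorem.** For all $s\ge 0$ and $n\ge 1$ there is a $\Sigma_n$-equivariant, basepoint preserving homeomorphism $$R^s(ku_n)/R^{s-1}(ku_n)\;\cong\;C_n(\mathfrak u_s)^+\wedge_{U(s)}L(\mathbb C^s,\mathrm{Sym}(\mathbb C^n))_+ .$$ -/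

import Mathlib

/-! ## The symmetric algebra of `ℂⁿ` with its preferred inner product -/

/-- The symmetric algebra `Sym(ℂⁿ)`. -/
def SymC (n : ℕ) : Type := SymmetricAlgebra ℂ (EuclideanSpace ℂ (Fin n))

namespace SymC

noncomputable instance (n : ℕ) : CommRing (SymC n) :=
  inferInstanceAs (CommRing (SymmetricAlgebra ℂ (EuclideanSpace ℂ (Fin n))))

noncomputable instance (n : ℕ) : Algebra ℂ (SymC n) :=
  inferInstanceAs (Algebra ℂ (SymmetricAlgebra ℂ (EuclideanSpace ℂ (Fin n))))

/-- The identification of `Sym(ℂⁿ)` with the polynomial ring on the standard basis of `ℂⁿ`. -/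
noncomputable def toPoly (n : ℕ) : SymC n ≃ₐ[ℂ] MvPolynomial (Fin n) ℂ :=
  SymmetricAlgebra.equivMvPolynomial (EuclideanSpace.basisFun (Fin n) ℂ).toBasis

/-- The hermitian form on polynomials for which distinct monomials are orthogonal and
`⟨e^α, e^α⟩ = α!`. -/
noncomputable def polyInner {n : ℕ} (p q : MvPolynomial (Fin n) ℂ) : ℂ :=
  ∑ α ∈ p.support,
    starRingEnd ℂ (p.coeff α) * q.coeff α * ((∏ i, (α i).factorial : ℕ) : ℂ)

theorem polyInner_eq {n : ℕ} (p q : MvPolynomial (Fin n) ℂ) (S : Finset (Fin n →₀ ℕ))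
    (hS : p.support ⊆ S) :
    polyInner p q = ∑ α ∈ S,
      starRingEnd ℂ (p.coeff α) * q.coeff α * ((∏ i, (α i).factorial : ℕ) : ℂ) := by
  refine Finset.sum_subset hS fun α _ hα => ?_
  simp [MvPolynomial.notMem_support_iff.mp hα]

theorem polyInner_self {n : ℕ} (p : MvPolynomial (Fin n) ℂ) :
    polyInner p p = ((∑ α ∈ p.support,
      ‖p.coeff α‖ ^ 2 * ((∏ i, (α i).factorial : ℕ) : ℝ) : ℝ) : ℂ) := by
  unfold polyInner
  rw [Complex.ofReal_sum]
  refine Finset.sum_congr rfl fun α _ => ?_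
  rw [Complex.conj_mul']
  push_cast
  ring

theorem polyInner_rename {n : ℕ} (σ : Equiv.Perm (Fin n)) (p q : MvPolynomial (Fin n) ℂ) :
    polyInner (MvPolynomial.rename σ p) (MvPolynomial.rename σ q) = polyInner p q := by
  classical
  unfold polyInner
  rw [MvPolynomial.support_rename_of_injective σ.injective,
    Finset.sum_image (Finsupp.mapDomain_injective σ.injective).injOn]
  refine Finset.sum_congr rfl fun α _ => ?_
  rw [MvPolynomial.coeff_rename_mapDomain _ σ.injective,
    MvPolynomial.coeff_rename_mapDomain _ σ.injective]
  congr 2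
  rw [← Equiv.prod_comp σ]
  refine Finset.prod_congr rfl fun i _ => ?_
  rw [Finsupp.mapDomain_apply σ.injective]

/-- The preferred inner product on `Sym(ℂⁿ)` (conjugate linear in the first variable): the one for
which the summands of different degree are orthogonal and
`⟨v₁⋯v_d, w₁⋯w_d⟩ = ∑_{τ ∈ Σ_d} ∏ᵢ ⟨vᵢ, w_{τ(i)}⟩`.  On the monomials in the standard basis this
reads `⟨e^α, e^β⟩ = α! · δ_{αβ}`. -/
@[reducible]
noncomputable def core (n : ℕ) : InnerProductSpace.Core ℂ (SymC n) where
  inner x y := polyInner (toPoly n x) (toPoly n y)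
  conj_inner_symm x y := by
    rw [polyInner_eq _ (toPoly n x) _ Finset.subset_union_left,
      polyInner_eq _ (toPoly n y) _
        (Finset.subset_union_right (s₁ := (toPoly n y).support)), map_sum]
    refine Finset.sum_congr rfl fun α _ => ?_
    simp only [map_mul, Complex.conj_conj, map_natCast]
    ring
  re_inner_nonneg x := by
    rw [polyInner_self]
    simp only [RCLike.re_to_complex, Complex.ofReal_re]
    positivity
  add_left x y z := by
    classical
    rw [map_add, polyInner_eq (toPoly n x) _ _ Finset.subset_union_left,
      polyInner_eq (toPoly n y) _ _
        (Finset.subset_union_right (s₁ := (toPoly n x).support)),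
      polyInner_eq _ _ _ MvPolynomial.support_add, ← Finset.sum_add_distrib]
    refine Finset.sum_congr rfl fun α _ => ?_
    simp only [MvPolynomial.coeff_add, map_add]
    ring
  smul_left x y r := by
    rw [map_smul, polyInner_eq _ _ _ MvPolynomial.support_smul, polyInner, Finset.mul_sum]
    refine Finset.sum_congr rfl fun α _ => ?_
    simp only [MvPolynomial.coeff_smul, smul_eq_mul, map_mul]
    ring
  definite x h := by
    rw [polyInner_self, Complex.ofReal_eq_zero,
      Finset.sum_eq_zero_iff_of_nonneg (fun _ _ => by positivity)] at h
    have hp : toPoly n x = 0 := by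
      ext α
      by_cases hα : α ∈ (toPoly n x).support
      · have h1 := h α hα
        have h2 : ((∏ i, (α i).factorial : ℕ) : ℝ) ≠ 0 := by
          exact_mod_cast Finset.prod_ne_zero_iff.mpr fun i _ => Nat.factorial_ne_zero _
        have h3 := (mul_eq_zero.mp h1).resolve_right h2
        simpa using h3
      · simpa using hα
    simpa using hp

noncomputable instance (n : ℕ) : NormedAddCommGroup (SymC n) :=
  @InnerProductSpace.Core.toNormedAddCommGroup ℂ (SymC n) _ _ _ (core n)

noncomputable instance (n : ℕ) : InnerProductSpace ℂ (SymC n) :=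
  InnerProductSpace.ofCore (core n).toCore

theorem inner_def {n : ℕ} (x y : SymC n) :
    inner ℂ x y = polyInner (toPoly n x) (toPoly n y) := rfl

/-- The algebra endomorphism `σ_*` of `Sym(ℂⁿ)` induced by the permutation `e_i ↦ e_{σ(i)}` of the
coordinates of `ℂⁿ`. -/
noncomputable def permHom {n : ℕ} (σ : Equiv.Perm (Fin n)) : SymC n →ₐ[ℂ] SymC n :=
  SymmetricAlgebra.lift (SymmetricAlgebra.ι ℂ (EuclideanSpace ℂ (Fin n)) ∘ₗ
    (LinearIsometryEquiv.piLpCongrLeft 2 ℂ ℂ σ).toLinearEquiv.toLinearMap)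

theorem toPoly_permHom {n : ℕ} (σ : Equiv.Perm (Fin n)) (x : SymC n) :
    toPoly n (permHom σ x) = MvPolynomial.rename σ (toPoly n x) := by
  have h : ((toPoly n : SymC n →ₐ[ℂ] MvPolynomial (Fin n) ℂ).comp (permHom σ)) =
      (MvPolynomial.rename σ).comp (toPoly n : SymC n →ₐ[ℂ] MvPolynomial (Fin n) ℂ) := by
    refine SymmetricAlgebra.algHom_ext ?_
    refine (EuclideanSpace.basisFun (Fin n) ℂ).toBasis.ext fun i => ?_
    have e1 : permHom σ (SymmetricAlgebra.ι ℂ _ (EuclideanSpace.single i (1 : ℂ))) =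
        SymmetricAlgebra.ι ℂ _ (EuclideanSpace.single (σ i) (1 : ℂ)) := by
      refine (SymmetricAlgebra.lift_ι_apply _ _).trans ?_
      refine congrArg (SymmetricAlgebra.ι ℂ (EuclideanSpace ℂ (Fin n))) ?_
      exact LinearIsometryEquiv.piLpCongrLeft_single (p := 2) (𝕜 := ℂ) (E := ℂ) σ i 1
    have e2 : ∀ j, toPoly n (SymmetricAlgebra.ι ℂ _ (EuclideanSpace.single j (1 : ℂ))) =
        MvPolynomial.X j := fun j => by
      have := SymmetricAlgebra.equivMvPolynomial_ι_apply
        (EuclideanSpace.basisFun (Fin n) ℂ).toBasis j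
      rw [OrthonormalBasis.coe_toBasis, EuclideanSpace.basisFun_apply] at this
      exact this
    have : toPoly n (permHom σ (SymmetricAlgebra.ι ℂ _ (EuclideanSpace.single i (1 : ℂ)))) =
        MvPolynomial.rename σ
          (toPoly n (SymmetricAlgebra.ι ℂ _ (EuclideanSpace.single i (1 : ℂ)))) := by
      rw [e1, e2, e2, MvPolynomial.rename_X]
    rw [OrthonormalBasis.coe_toBasis, EuclideanSpace.basisFun_apply]
    exact this
  exact DFunLike.congr_fun h x

/-- The isometry `σ_* : Sym(ℂⁿ) → Sym(ℂⁿ)`. -/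
noncomputable def perm {n : ℕ} (σ : Equiv.Perm (Fin n)) : SymC n →ₗᵢ[ℂ] SymC n :=
  (permHom σ).toLinearMap.isometryOfInner fun x y => by
    simp only [inner_def, AlgHom.toLinearMap_apply, toPoly_permHom, polyInner_rename]

theorem perm_one {n : ℕ} : perm (1 : Equiv.Perm (Fin n)) = LinearIsometry.id := by
  ext x
  apply (toPoly n).injective
  refine (toPoly_permHom _ _).trans ?_
  simp

theorem perm_mul {n : ℕ} (σ τ : Equiv.Perm (Fin n)) : perm (σ * τ) = (perm σ).comp (perm τ) := by
  ext x
  apply (toPoly n).injective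
  refine (toPoly_permHom _ _).trans ?_
  refine Eq.trans ?_ (toPoly_permHom σ (permHom τ x)).symm
  rw [toPoly_permHom, MvPolynomial.rename_rename, Equiv.Perm.coe_mul]

end SymC

/-! ## Spaces of linear isometric embeddings -/

section Isometries

variable (V W : Type) [NormedAddCommGroup V] [InnerProductSpace ℂ V]
  [NormedAddCommGroup W] [InnerProductSpace ℂ W]

/-- The set `L(V,W)` of linear isometric embeddings `V ↪ W`. -/
def IsoEmb : Type := V →ₗᵢ[ℂ] W

/-- The topology of the Stiefel manifold (that is, of pointwise convergence) on `L(V,W)`; it is the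
one to use when `V` and `W` are finite dimensional. -/
@[reducible]
def stiefelTopology : TopologicalSpace (V →ₗᵢ[ℂ] W) :=
  TopologicalSpace.induced (fun f (v : V) => f v) inferInstance

/-- The colimit topology on `L(V,W)`: the finest one for which the inclusions `L(V,W') → L(V,W)` are
continuous, for all finite dimensional subspaces `W'` of `W`.  (Since `V` is finite dimensional in
all uses, these inclusions are jointly surjective.) -/
noncomputable instance : TopologicalSpace (IsoEmb V W) :=
  ⨆ W' : {W' : Submodule ℂ W // FiniteDimensional ℂ W'},
    TopologicalSpace.coinduced
      (fun f : V →ₗᵢ[ℂ] W'.1 => (W'.1.subtypeₗᵢ.comp f : V →ₗᵢ[ℂ] W))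
      (stiefelTopology V W'.1)

end Isometries

/-! ## The `Γ`-space `ku(-,U)` and its extension to pointed spaces -/

section GammaSpace

variable (U : Type) [NormedAddCommGroup U] [InnerProductSpace ℂ U]

/-- `ku(⟨k⟩,U)` as a set: the `k`-tuples of mutually orthogonal finite dimensional subspaces. -/
@[ext]
structure OrthTuple (k : ℕ) : Type where
  space : Fin k → Submodule ℂ U
  finite : ∀ i, FiniteDimensional ℂ (space i)
  ortho : ∀ i j, i ≠ j → space i ⟂ space j

variable {U}

/-- The orthogonal sum `ℂ^{m₁} ⊕ ⋯ ⊕ ℂ^{m_k}`. -/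
abbrev BlockSum {k : ℕ} (m : Fin k → ℕ) : Type :=
  PiLp 2 fun i => EuclideanSpace ℂ (Fin (m i))

/-- The `i`-th summand of `ℂ^{m₁} ⊕ ⋯ ⊕ ℂ^{m_k}`. -/
def blockSummand {k : ℕ} (m : Fin k → ℕ) (i : Fin k) : Submodule ℂ (BlockSum m) where
  carrier := {x | ∀ j, j ≠ i → x j = 0}
  add_mem' hx hy j hj := by simp [hx j hj, hy j hj]
  zero_mem' j _ := by simp
  smul_mem' c x hx j hj := by simp [hx j hj]

/-- The tuple of the images of the summands under an isometric embedding
`ℂ^{m₁} ⊕ ⋯ ⊕ ℂ^{m_k} ↪ U`. Two embeddings have the same tuple if and only if they differ by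
precomposition with an element of `U(m₁) × ⋯ × U(m_k)`. -/
noncomputable def OrthTuple.ofFrame {k : ℕ} (f : Σ m : Fin k → ℕ, IsoEmb (BlockSum m) U) : OrthTuple U k where
  space i := (blockSummand f.1 i).map (LinearIsometry.toLinearMap (σ₁₂ := RingHom.id ℂ) f.2)
  finite i := inferInstance
  ortho i j hij := by
    rw [Submodule.isOrtho_iff_inner_eq]
    rintro _ ⟨x, hx, rfl⟩ _ ⟨y, hy, rfl⟩
    refine (LinearIsometry.inner_map_map (show BlockSum f.1 →ₗᵢ[ℂ] U from f.2) x y).trans ?_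
    rw [PiLp.inner_apply]
    refine Finset.sum_eq_zero fun l _ => ?_
    by_cases hl : l = i
    · rw [hy l (hl ▸ hij), inner_zero_right]
    · rw [hx l hl, inner_zero_left]

/-- The topology of `⨆_{m₁,…,m_k} L(ℂ^{m₁} ⊕ ⋯ ⊕ ℂ^{m_k},U)/(U(m₁) × ⋯ × U(m_k))`, i.e. the quotient
topology along `OrthTuple.ofFrame`. -/
noncomputable instance (k : ℕ) : TopologicalSpace (OrthTuple U k) :=
  TopologicalSpace.coinduced OrthTuple.ofFrame inferInstance

/-- A based map `⟨k⟩ → ⟨l⟩`, where `⟨k⟩ = {0,1,…,k}` has basepoint `0`. -/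
abbrev FinBased (k l : ℕ) : Type := {α : Fin (k + 1) → Fin (l + 1) // α 0 = 0}

/-- The map `ku(α,U)`, sending `(V_j)` to `(W_i)` with `W_i = ⨁_{α(j) = i} V_j`. -/
def OrthTuple.push {k l : ℕ} (α : FinBased k l) (V : OrthTuple U k) : OrthTuple U l where
  space i := ⨆ j : {j : Fin k // α.1 j.succ = i.succ}, V.space j
  finite i := by
    have := V.finite
    infer_instance
  ortho i i' h := by
    rw [Submodule.isOrtho_iSup_left]
    intro j
    rw [Submodule.isOrtho_iSup_right]
    intro j'
    refine V.ortho _ _ fun hjj => h ?_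
    have h1 := j.2
    rw [hjj, j'.2] at h1
    exact (Fin.succ_injective _ h1).symm

/-- The space `Map_*(⟨k⟩,X)`, for a space `X` with basepoint `x₀`, as a subspace of `X^{k+1}`. -/
abbrev BasedMap (k : ℕ) (X : Type) (x₀ : X) : Type := {x : Fin (k + 1) → X // x 0 = x₀}

/-- The restriction `Map_*(⟨l⟩,X) → Map_*(⟨k⟩,X)` along `α : ⟨k⟩ → ⟨l⟩`. -/
def BasedMap.pull {k l : ℕ} {X : Type} {x₀ : X} (α : FinBased k l) (x : BasedMap l X x₀) :
    BasedMap k X x₀ :=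
  ⟨x.1 ∘ α.1, by simp [α.2, x.2]⟩

variable (U)

/-- The disjoint union over `k` of `ku(⟨k⟩,U) × Map_*(⟨k⟩,X)`. -/
abbrev PreKU (X : Type) (x₀ : X) : Type := Σ k : ℕ, OrthTuple U k × BasedMap k X x₀

/-- The identifications `(α_* V, x) ∼ (V, α^* x)` of the coend. -/
inductive PreKU.Rel (X : Type) (x₀ : X) : PreKU U X x₀ → PreKU U X x₀ → Prop
  | glue {k l : ℕ} (α : FinBased k l) (V : OrthTuple U k) (x : BasedMap l X x₀) :
      PreKU.Rel X x₀ ⟨l, V.push α, x⟩ ⟨k, V, x.pull α⟩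

/-- The coend `ku(X,U) = ∫^{⟨k⟩} ku(⟨k⟩,U) × Map_*(⟨k⟩,X)`. -/
def KU (X : Type) (x₀ : X) : Type := Quot (PreKU.Rel U X x₀)

/-- The class `[(V_1,x_1),…,(V_k,x_k)]` in `ku(X,U)`. -/
def KU.mk {U : Type} [NormedAddCommGroup U] [InnerProductSpace ℂ U] {X : Type} {x₀ : X} (c : PreKU U X x₀) : KU U X x₀ := Quot.mk _ c

/-- The quotient topology on `ku(X,U)`. -/
noncomputable instance (X : Type) [TopologicalSpace X] (x₀ : X) : TopologicalSpace (KU U X x₀) :=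
  inferInstanceAs (TopologicalSpace (Quot (PreKU.Rel U X x₀)))

/-- The number `∑_{x_i ≠ basepoint} dim V_i` attached to `(V_1,x_1),…,(V_k,x_k)`. -/
noncomputable def PreKU.rank {X : Type} {x₀ : X} (c : PreKU U X x₀) : ℕ :=
  open Classical in
  ∑ i : Fin c.1 with c.2.2.1 i.succ ≠ x₀, Module.finrank ℂ (c.2.1.space i)

/-- The rank filtration: the classes of configurations of rank at most `s`, where `s ≥ -1`. -/
def rankFiltration (X : Type) (x₀ : X) (s : ℤ) : Set (KU U X x₀) :=
  {p | ∃ c : PreKU U X x₀, p = KU.mk c ∧ (c.rank : ℤ) ≤ s}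

end GammaSpace

/-! ## The `n`-th space of `ku` with its action of `Σ_n` -/

/-- `Sⁿ`, as the one-point compactification of the permutation representation `ℝⁿ`; its basepoint
is the point at infinity. -/
abbrev Sph (n : ℕ) : Type := OnePoint (Fin n → ℝ)

/-- The action of `Σ_n` on `Sⁿ`, extending the one on `ℝⁿ` with `σ · e_i = e_{σ(i)}`. -/
def Sph.perm {n : ℕ} (σ : Equiv.Perm (Fin n)) : Sph n → Sph n :=
  OnePoint.map fun x i => x (σ⁻¹ i)

theorem Sph.perm_one {n : ℕ} (x : Sph n) : Sph.perm 1 x = x := by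
  induction x using OnePoint.rec <;> rfl

theorem Sph.perm_mul {n : ℕ} (σ τ : Equiv.Perm (Fin n)) (x : Sph n) :
    Sph.perm (σ * τ) x = Sph.perm σ (Sph.perm τ x) := by
  induction x using OnePoint.rec
  · rfl
  · simp [Sph.perm, mul_inv_rev]

theorem Sph.perm_eq_infty {n : ℕ} (σ : Equiv.Perm (Fin n)) (x : Sph n) :
    Sph.perm σ x = OnePoint.infty ↔ x = OnePoint.infty := by
  induction x using OnePoint.rec <;> simp [Sph.perm]

/-- `ku_n = ku(Sⁿ, Sym(ℂⁿ))`. -/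
abbrev KuSpace (n : ℕ) : Type := KU (SymC n) (Sph n) OnePoint.infty

/-- `(V_i, x_i)_i ↦ (σ_* V_i, σ · x_i)_i`. -/
noncomputable def preKuPerm {n : ℕ} (σ : Equiv.Perm (Fin n))
    (c : PreKU (SymC n) (Sph n) OnePoint.infty) : PreKU (SymC n) (Sph n) OnePoint.infty :=
  ⟨c.1,
    { space := fun i => (c.2.1.space i).map (SymC.perm σ).toLinearMap
      finite := fun i => by
        have := c.2.1.finite i
        infer_instance
      ortho := fun i j h => (c.2.1.ortho i j h).map (SymC.perm σ) },
    ⟨fun i => Sph.perm σ (c.2.2.1 i), (congrArg (Sph.perm σ) c.2.2.2).trans rfl⟩⟩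

noncomputable instance (n : ℕ) : SMul (Equiv.Perm (Fin n)) (KuSpace n) where
  smul σ := Quot.map (preKuPerm σ) (by
    rintro _ _ ⟨α, V, x⟩
    have h := PreKU.Rel.glue α (preKuPerm σ ⟨_, V, x.pull α⟩).2.1 (preKuPerm σ ⟨_, V.push α, x⟩).2.2
    have e : (preKuPerm σ ⟨_, V, x.pull α⟩).2.1.push α = (preKuPerm σ ⟨_, V.push α, x⟩).2.1 := by
      ext1
      funext i
      exact (Submodule.map_iSup _ _).symm
    rw [e] at h
    exact h)

theorem kuSpace_smul_mk {n : ℕ} (σ : Equiv.Perm (Fin n))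
    (c : PreKU (SymC n) (Sph n) OnePoint.infty) :
    σ • (KU.mk c : KuSpace n) = KU.mk (preKuPerm σ c) := rfl

theorem preKuPerm_one {n : ℕ} (c : PreKU (SymC n) (Sph n) OnePoint.infty) :
    preKuPerm 1 c = c := by
  obtain ⟨k, V, x⟩ := c
  refine Sigma.ext rfl (heq_of_eq (Prod.ext ?_ (Subtype.ext ?_)))
  · ext1
    funext i
    simp only [preKuPerm, SymC.perm_one]
    exact Submodule.map_id _
  · funext i
    exact Sph.perm_one _

theorem preKuPerm_mul {n : ℕ} (σ τ : Equiv.Perm (Fin n))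
    (c : PreKU (SymC n) (Sph n) OnePoint.infty) :
    preKuPerm (σ * τ) c = preKuPerm σ (preKuPerm τ c) := by
  obtain ⟨k, V, x⟩ := c
  refine Sigma.ext rfl (heq_of_eq (Prod.ext ?_ (Subtype.ext ?_)))
  · ext1
    funext i
    simp only [preKuPerm, SymC.perm_mul]
    exact Submodule.map_comp _ _ _
  · funext i
    exact Sph.perm_mul _ _ _

/-- The action of `Σ_n` on `ku_n`, with `σ · [(V_i,x_i)_i] = [(σ_* V_i, σ · x_i)_i]`. -/
noncomputable instance (n : ℕ) : MulAction (Equiv.Perm (Fin n)) (KuSpace n) where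
  one_smul p := by
    obtain ⟨c⟩ := p
    exact congrArg KU.mk (preKuPerm_one c)
  mul_smul σ τ p := by
    obtain ⟨c⟩ := p
    exact congrArg KU.mk (preKuPerm_mul σ τ c)

/-- `R^s(ku_n)`. -/
abbrev RankKu (n : ℕ) (s : ℤ) : Set (KuSpace n) := rankFiltration (SymC n) (Sph n) OnePoint.infty s

theorem preKuPerm_rank {n : ℕ} (σ : Equiv.Perm (Fin n))
    (c : PreKU (SymC n) (Sph n) OnePoint.infty) : (preKuPerm σ c).rank = c.rank := by
  obtain ⟨k, V, x⟩ := c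
  unfold PreKU.rank
  rw [Finset.sum_filter, Finset.sum_filter]
  refine Finset.sum_congr rfl fun i _ => ?_
  have h1 : (preKuPerm σ ⟨k, V, x⟩).2.2.1 i.succ ≠ OnePoint.infty ↔ x.1 i.succ ≠ OnePoint.infty :=
    not_congr (Sph.perm_eq_infty σ _)
  have h2 : Module.finrank ℂ ((preKuPerm σ ⟨k, V, x⟩).2.1.space i) =
      Module.finrank ℂ (V.space i) :=
    (Submodule.equivMapOfInjective (SymC.perm σ).toLinearMap (SymC.perm σ).injective
      (V.space i)).finrank_eq.symm
  by_cases h : x.1 i.succ ≠ OnePoint.infty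
  · exact (if_pos (h1.mpr h)).trans (h2.trans (if_pos h).symm)
  · exact (if_neg (h1.not.mpr h)).trans (if_neg h).symm

theorem smul_mem_RankKu {n : ℕ} {s : ℤ} (σ : Equiv.Perm (Fin n)) {p : KuSpace n} (hp : p ∈ RankKu n s) :
    σ • p ∈ RankKu n s := by
  obtain ⟨c, rfl, hc⟩ := hp
  exact ⟨preKuPerm σ c, rfl, by rwa [preKuPerm_rank]⟩

/-! ## The subquotients of the rank filtration -/

/-- The identifications defining `A/B`: all points of `B` are glued to an added point. -/
inductive CollapseRel {X : Type} (A B : Set X) : A ⊕ Unit → A ⊕ Unit → Prop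
  | glue (a : A) (ha : (a : X) ∈ B) : CollapseRel A B (Sum.inl a) (Sum.inr ())

/-- The pointed space `A/B`, for subspaces `B ⊆ A` of a space `X`: the pushout of `A ← B → pt`.
In particular `A/∅` is `A` with a disjoint basepoint. -/
def Collapse {X : Type} (A B : Set X) : Type := Quot (CollapseRel A B)

instance {X : Type} [TopologicalSpace X] (A B : Set X) : TopologicalSpace (Collapse A B) :=
  inferInstanceAs (TopologicalSpace (Quot (CollapseRel A B)))

/-- The basepoint of `A/B`. -/
def Collapse.base {X : Type} (A B : Set X) : Collapse A B := Quot.mk _ (Sum.inr ())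

/-- The map `A/B → A/B` induced by `f : X → X` with `f(A) ⊆ A` and `f(B) ⊆ B`. -/
def Collapse.map {X : Type} {A B : Set X} (f : X → X) (hA : Set.MapsTo f A A)
    (hB : Set.MapsTo f B B) : Collapse A B → Collapse A B :=
  Quot.map (Sum.map (hA.restrict f A A) id) (by
    rintro _ _ ⟨a, ha⟩
    exact .glue _ (hB ha))

theorem Collapse.map_id {X : Type} {A B : Set X} (f : X → X) (hA : Set.MapsTo f A A)
    (hB : Set.MapsTo f B B) (hf : ∀ x, f x = x) (p : Collapse A B) :
    Collapse.map f hA hB p = p := by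
  obtain rfl : f = id := funext hf
  obtain ⟨p | p⟩ := p <;> rfl

theorem Collapse.map_comp {X : Type} {A B : Set X} (f g h : X → X) (hA : Set.MapsTo f A A)
    (hB : Set.MapsTo f B B) (gA : Set.MapsTo g A A) (gB : Set.MapsTo g B B)
    (kA : Set.MapsTo h A A) (kB : Set.MapsTo h B B) (hf : ∀ x, f x = g (h x))
    (p : Collapse A B) :
    Collapse.map f hA hB p = Collapse.map g gA gB (Collapse.map h kA kB p) := by
  obtain rfl : f = g ∘ h := funext hf
  obtain ⟨p | p⟩ := p <;> rfl

/-- The subquotient `R^s(ku_n)/R^{s-1}(ku_n)`. -/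
abbrev RankSubquotient (n s : ℕ) : Type := Collapse (RankKu n (s : ℤ)) (RankKu n ((s : ℤ) - 1))

/-- The action of `Σ_n` on `R^s(ku_n)/R^{s-1}(ku_n)` induced by the one on `ku_n`. -/
noncomputable instance (n s : ℕ) : MulAction (Equiv.Perm (Fin n)) (RankSubquotient n s) where
  smul σ := Collapse.map (fun p => σ • p) (fun _ hp => smul_mem_RankKu σ hp)
    (fun _ hp => smul_mem_RankKu σ hp)
  one_smul := Collapse.map_id _ _ _ (one_smul _)
  mul_smul σ τ := Collapse.map_comp _ _ _ _ _ _ _ _ _ (mul_smul σ τ)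

/-! ## Commuting skew-Hermitian matrices and the half-smash product -/

/-- `C_n(𝔲_s)`: the `n`-tuples of pairwise commuting skew-Hermitian `s × s` matrices. -/
def CommVar (n s : ℕ) : Type :=
  {X : Fin n → Matrix (Fin s) (Fin s) ℂ //
    (∀ i, (X i).conjTranspose = -X i) ∧ ∀ i j, X i * X j = X j * X i}

/-- The Euclidean topology on `C_n(𝔲_s)`. -/
instance (n s : ℕ) : TopologicalSpace (CommVar n s) :=
  inferInstanceAs (TopologicalSpace {X : Fin n → Matrix (Fin s) (Fin s) ℂ //
    (∀ i, (X i).conjTranspose = -X i) ∧ ∀ i j, X i * X j = X j * X i})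

/-- The action of `U(s)` on `C_n(𝔲_s)`: simultaneous conjugation `X_i ↦ g X_i g⁻¹`. -/
def CommVar.conj {n s : ℕ} (g : Matrix.unitaryGroup (Fin s) ℂ) (X : CommVar n s) : CommVar n s :=
  ⟨fun i => g.1 * X.1 i * (g⁻¹).1, by
    have hg : (g⁻¹).1 * g.1 = 1 := by
      rw [← Submonoid.coe_mul, inv_mul_cancel, Submonoid.coe_one]
    refine ⟨fun i => ?_, fun i j => ?_⟩
    · have e : (g⁻¹).1 = g.1.conjTranspose := rfl
      simp only [e, Matrix.conjTranspose_mul, Matrix.conjTranspose_conjTranspose, X.2.1 i]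
      noncomm_ring
    · have key : ∀ a b, g.1 * X.1 a * (g⁻¹).1 * (g.1 * X.1 b * (g⁻¹).1) =
          g.1 * (X.1 a * X.1 b) * (g⁻¹).1 := fun a b => by
        calc _ = g.1 * X.1 a * ((g⁻¹).1 * g.1) * X.1 b * (g⁻¹).1 := by noncomm_ring
          _ = _ := by rw [hg]; noncomm_ring
      rw [key, key, X.2.2 i j]⟩

/-- `σ · (X_1,…,X_n)`, the tuple whose `σ(i)`-th entry is `X_i`. -/
def CommVar.perm {n s : ℕ} (σ : Equiv.Perm (Fin n)) (X : CommVar n s) : CommVar n s :=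
  ⟨fun i => X.1 (σ⁻¹ i), fun _ => X.2.1 _, fun _ _ => X.2.2 _ _⟩

/-- The isometry of `ℂ^s` given by a unitary matrix. -/
noncomputable def unitaryIso {s : ℕ} (g : Matrix.unitaryGroup (Fin s) ℂ) :
    EuclideanSpace ℂ (Fin s) →ₗᵢ[ℂ] EuclideanSpace ℂ (Fin s) :=
  (Matrix.toEuclideanLin g.1).isometryOfInner fun x y => by
    rw [← LinearMap.adjoint_inner_right, ← Matrix.toEuclideanLin_conjTranspose_eq_adjoint,
      ← Matrix.star_eq_conjTranspose]
    congr 1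
    apply (WithLp.equiv 2 _).injective
    simp [Matrix.toEuclideanLin, Matrix.toLpLin]

/-- `L(ℂ^s, Sym(ℂⁿ))`. -/
abbrev Frames (n s : ℕ) : Type := IsoEmb (EuclideanSpace ℂ (Fin s)) (SymC n)

/-- The right action `f ↦ f ∘ g` of `U(s)` on `L(ℂ^s, Sym(ℂⁿ))`. -/
noncomputable def Frames.precomp {n s : ℕ} (f : Frames n s) (g : Matrix.unitaryGroup (Fin s) ℂ) :
    Frames n s :=
  LinearIsometry.comp (σ₁₂ := RingHom.id ℂ) (σ₂₃ := RingHom.id ℂ) f (unitaryIso g)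

/-- `f ↦ σ_* ∘ f`. -/
noncomputable def Frames.perm {n s : ℕ} (σ : Equiv.Perm (Fin n)) (f : Frames n s) : Frames n s :=
  (SymC.perm σ).comp (σ₁₂ := RingHom.id ℂ) f

/-- `C_n(𝔲_s)^+ × L(ℂ^s, Sym(ℂⁿ))_+`, where `(-)^+` is the one-point compactification and `(-)_+`
adds a disjoint basepoint. -/
abbrev PreHalfSmash (n s : ℕ) : Type := OnePoint (CommVar n s) × (Frames n s ⊕ Unit)

/-- The identifications defining `C_n(𝔲_s)^+ ∧_{U(s)} L(ℂ^s, Sym(ℂⁿ))_+`: the points with a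
coordinate at a basepoint form one class, and `(gX, f) ∼ (X, f ∘ g)` for `g ∈ U(s)`, where
`U(s)` fixes the point at infinity. -/
inductive HalfSmashRel (n s : ℕ) : PreHalfSmash n s → PreHalfSmash n s → Prop
  | collapse (p q : PreHalfSmash n s) (hp : p.1 = OnePoint.infty ∨ p.2 = Sum.inr ())
      (hq : q.1 = OnePoint.infty ∨ q.2 = Sum.inr ()) : HalfSmashRel n s p q
  | balance (g : Matrix.unitaryGroup (Fin s) ℂ) (c : OnePoint (CommVar n s)) (f : Frames n s) :
      HalfSmashRel n s (OnePoint.map (CommVar.conj g) c, Sum.inl f) (c, Sum.inl (f.precomp g))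

/-- The space `C_n(𝔲_s)^+ ∧_{U(s)} L(ℂ^s, Sym(ℂⁿ))_+`. -/
def HalfSmash (n s : ℕ) : Type := Quot (HalfSmashRel n s)

/-- The quotient topology. -/
instance (n s : ℕ) : TopologicalSpace (HalfSmash n s) :=
  inferInstanceAs (TopologicalSpace (Quot (HalfSmashRel n s)))

/-- The basepoint of `C_n(𝔲_s)^+ ∧_{U(s)} L(ℂ^s, Sym(ℂⁿ))_+`. -/
def HalfSmash.base (n s : ℕ) : HalfSmash n s := Quot.mk _ (OnePoint.infty, Sum.inr ())

/-- `(X, f) ↦ (σ · X, σ_* ∘ f)`. -/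
noncomputable def preHalfSmashPerm {n s : ℕ} (σ : Equiv.Perm (Fin n)) (p : PreHalfSmash n s) :
    PreHalfSmash n s :=
  (OnePoint.map (CommVar.perm σ) p.1, Sum.map (Frames.perm σ) id p.2)

noncomputable instance (n s : ℕ) : SMul (Equiv.Perm (Fin n)) (HalfSmash n s) where
  smul σ := Quot.map (preHalfSmashPerm σ) (by
    have key : ∀ p : PreHalfSmash n s, (p.1 = OnePoint.infty ∨ p.2 = Sum.inr ()) →
        ((preHalfSmashPerm σ p).1 = OnePoint.infty ∨ (preHalfSmashPerm σ p).2 = Sum.inr ()) := by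
      rintro ⟨p, q⟩ (h | h) <;> simp only at h <;> subst h <;> simp [preHalfSmashPerm]
    rintro _ _ (⟨_, _, hp, hq⟩ | ⟨g, c, f⟩)
    · exact .collapse _ _ (key _ hp) (key _ hq)
    · have h := HalfSmashRel.balance g (OnePoint.map (CommVar.perm σ) c) (Frames.perm σ f)
      have e : OnePoint.map (CommVar.conj g) (OnePoint.map (CommVar.perm σ) c) =
          OnePoint.map (CommVar.perm σ) (OnePoint.map (CommVar.conj g) c) := by
        induction c using OnePoint.rec <;> rfl
      rw [e] at h
      exact h)

/-- The action `σ · [(X_1,…,X_n) ∧ f] = [(X_{σ⁻¹(1)},…,X_{σ⁻¹(n)}) ∧ (σ_* ∘ f)]` of `Σ_n`. -/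
noncomputable instance (n s : ℕ) : MulAction (Equiv.Perm (Fin n)) (HalfSmash n s) where
  one_smul p := by
    obtain ⟨c, f⟩ := p
    refine congrArg (Quot.mk _) (Prod.ext ?_ ?_)
    · induction c using OnePoint.rec <;> rfl
    · obtain f | f := f
      · refine congrArg Sum.inl ?_
        simp only [Frames.perm, SymC.perm_one]
        rfl
      · rfl
  mul_smul σ τ p := by
    obtain ⟨c, f⟩ := p
    refine congrArg (Quot.mk _) (Prod.ext ?_ ?_)
    · induction c using OnePoint.rec <;> rfl
    · obtain f | f := f
      · refine congrArg Sum.inl ?_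
        simp only [Frames.perm, SymC.perm_mul]
        rfl
      · rfl

/-! Both sides are quotients of one space of labelled frames, `(Sⁿ)^s × L(ℂ^s, Sym(ℂⁿ))_+`. A pair
`(x, f)` gives on one side the configuration of the lines `ℂ·f(e_j)` placed at `x_j`, and on the
other side the class of `diag(√-1 x_1, …, √-1 x_s) ∧ f`, read as the basepoint if some `x_j` is
infinite. The theorem follows once both maps are shown to be quotient maps with the same fibres
(`Topology.IsQuotientMap.exists_homeomorph`); they are equivariant for the same action on labelled
frames.

Fibres (`labelledToSubquotient_eq_iff_labelledToHalfSmash_eq`). Both basepoint fibres consist of the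
pairs with an infinite label or with the added point as frame. Elsewhere each class is determined by
the subspaces spanned by the `f(e_j)` with `x_j = y`, for all `y ∈ ℝⁿ`. On the left these are the
subspaces of the configuration, which determine it by `KU.part_injective`. On the right they are the
images under `f` of the joint eigenspaces; if they agree for two labelled frames, the frames differ
by a unitary matrix carrying one diagonal tuple to the other.

Quotient map to the half-smash product (`isQuotientMap_labelledToHalfSmash`). By simultaneous
diagonalization, the compact space `U(s) × (Sⁿ)^s`, with a point added, surjects onto the Hausdorff
space `C_n(𝔲_s)^+`. This map is proper, so its product with `L(ℂ^s, Sym(ℂⁿ))_+` is still a closed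
quotient map, and the unitary factor can be absorbed into the frame.

Quotient map to the subquotient (`isQuotientMap_labelledToSubquotient`). Closedness is tested on the
pieces `L(ℂ^{m₁} ⊕ ⋯ ⊕ ℂ^{m_k}, U) × Map_*(⟨k⟩, X)`. There the condition to be checked is a finite
union of closed ones, indexed by the ways to select `s` basis vectors, or fewer than `s` dimensions
of summands, such that everything not selected sits at the basepoint. -/

open Topology

/-! ## Orthonormal families and frames -/

section Frame

variable {U : Type} [NormedAddCommGroup U] [InnerProductSpace ℂ U]

/-- The linear isometric embedding sending an orthonormal basis to an orthonormal family. -/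
noncomputable def isoOfOrthonormal {ι E : Type} [Fintype ι] [NormedAddCommGroup E]
    [InnerProductSpace ℂ E] (b : OrthonormalBasis ι ℂ E) (v : ι → U) (hv : Orthonormal ℂ v) :
    E →ₗᵢ[ℂ] U :=
  (b.toBasis.constr ℂ v).isometryOfOrthonormal (v := b.toBasis) (by simp)
    (by
      have : (b.toBasis.constr ℂ v : E →ₗ[ℂ] U) ∘ b.toBasis = v :=
        funext fun i => b.toBasis.constr_basis ℂ v i
      rwa [this])

theorem isoOfOrthonormal_apply {ι E : Type} [Fintype ι] [NormedAddCommGroup E]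
    [InnerProductSpace ℂ E] (b : OrthonormalBasis ι ℂ E) (v : ι → U) (hv : Orthonormal ℂ v)
    (i : ι) : isoOfOrthonormal b v hv (b i) = v i := by
  have := b.toBasis.constr_basis ℂ v i
  rwa [OrthonormalBasis.coe_toBasis] at this

/-- The standard orthonormal basis of `ℂ^{m₁} ⊕ ⋯ ⊕ ℂ^{m_k}`. -/
noncomputable def blockBasis {k : ℕ} (m : Fin k → ℕ) :
    OrthonormalBasis (Σ i, Fin (m i)) ℂ (BlockSum m) :=
  Pi.orthonormalBasis fun i => EuclideanSpace.basisFun (Fin (m i)) ℂ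

theorem blockSummand_eq_span {k : ℕ} (m : Fin k → ℕ) (i : Fin k) :
    blockSummand m i = Submodule.span ℂ (Set.range fun l => blockBasis m ⟨i, l⟩) := by
  apply le_antisymm
  · intro x hx
    rw [← (blockBasis m).sum_repr x]
    refine Submodule.sum_mem _ fun ⟨j, l⟩ _ => ?_
    by_cases h : j = i
    · subst h
      exact Submodule.smul_mem _ _ (Submodule.subset_span ⟨l, rfl⟩)
    · have : (blockBasis m).repr x ⟨j, l⟩ = 0 := by
        have h1 : (blockBasis m).repr x ⟨j, l⟩ =
          (EuclideanSpace.basisFun (Fin (m j)) ℂ).repr (x j) l := rfl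
        rw [h1, hx j h]
        simp
      rw [this, zero_smul]
      exact zero_mem _
  · rw [Submodule.span_le]
    rintro _ ⟨l, rfl⟩ j hj
    simp [blockBasis, Ne.symm hj]

theorem OrthTuple.ofFrame_space {k : ℕ} (m : Fin k → ℕ) (F : BlockSum m →ₗᵢ[ℂ] U) (i : Fin k) :
    (OrthTuple.ofFrame ⟨m, F⟩).space i =
      Submodule.span ℂ (Set.range fun l => F (blockBasis m ⟨i, l⟩)) := by
  refine (congrArg (Submodule.map F.toLinearMap) (blockSummand_eq_span m i)).trans ?_
  rw [Submodule.map_span, ← Set.range_comp]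
  rfl

theorem OrthTuple.finrank_ofFrame_space {k : ℕ} (m : Fin k → ℕ) (F : BlockSum m →ₗᵢ[ℂ] U)
    (i : Fin k) : Module.finrank ℂ ((OrthTuple.ofFrame ⟨m, F⟩).space i) = m i := by
  rw [OrthTuple.ofFrame_space]
  have h : LinearIndependent ℂ fun l : Fin (m i) => F (blockBasis m ⟨i, l⟩) :=
    (((blockBasis m).orthonormal.comp_linearIsometry F).comp _
      (sigma_mk_injective (i := i))).linearIndependent
  simpa using finrank_span_eq_card h

/-- Orthonormal bases of the single subspaces combine to one orthonormal family because the
subspaces are mutually orthogonal. -/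
theorem OrthTuple.ofFrame_surjective (k : ℕ) :
    Function.Surjective (OrthTuple.ofFrame : _ → OrthTuple U k) := by
  intro V
  have := V.finite
  have hV : OrthogonalFamily ℂ (fun i => V.space i) fun i => (V.space i).subtypeₗᵢ :=
    OrthogonalFamily.of_pairwise fun i j h => V.ortho i j h
  have hv := hV.orthonormal_sigma_orthonormal
    (v_family := fun i => stdOrthonormalBasis ℂ (V.space i))
    fun i => (stdOrthonormalBasis ℂ (V.space i)).orthonormal
  refine ⟨⟨fun i => Module.finrank ℂ (V.space i), isoOfOrthonormal (blockBasis _) _ hv⟩, ?_⟩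
  ext1
  funext i
  rw [OrthTuple.ofFrame_space]
  simp only [isoOfOrthonormal_apply]
  have h := congrArg (Submodule.map (V.space i).subtype)
    (stdOrthonormalBasis ℂ (V.space i)).toBasis.span_eq
  rw [Submodule.map_span, ← Set.range_comp, Submodule.map_subtype_top] at h
  simpa [Function.comp_def] using h

end Frame

/-! ## Points of `ku(X,U)` as labelled families of subspaces -/

section Parts

variable {U : Type} [NormedAddCommGroup U] [InnerProductSpace ℂ U] {X : Type} {x₀ : X}

/-- The sum of the subspaces placed at the point `y`. -/
def PreKU.part (c : PreKU U X x₀) (y : X) : Submodule ℂ U :=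
  ⨆ i : {i : Fin c.1 // c.2.2.1 i.succ = y}, c.2.1.space i

/-- A subspace `V_j` with `α(j) = 0` is lost in `V.push α`, but its pulled back label is `x₀`. Hence
the restriction to `y ≠ x₀`. -/
theorem PreKU.part_glue {k l : ℕ} (α : FinBased k l) (V : OrthTuple U k) (x : BasedMap l X x₀)
    {y : X} (hy : y ≠ x₀) :
    PreKU.part (⟨l, V.push α, x⟩ : PreKU U X x₀) y = PreKU.part ⟨k, V, x.pull α⟩ y := by
  apply le_antisymm
  · refine iSup_le fun ⟨i, hi⟩ => iSup_le fun ⟨j, hj⟩ => ?_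
    refine le_iSup_of_le ⟨j, ?_⟩ le_rfl
    change x.1 (α.1 j.succ) = y
    rw [hj]
    exact hi
  · refine iSup_le fun ⟨j, hj⟩ => ?_
    change x.1 (α.1 j.succ) = y at hj
    obtain ⟨i, hi⟩ : ∃ i, Fin.succ i = α.1 j.succ := by
      refine Fin.exists_succ_eq.2 fun h => hy ?_
      rw [← hj, h, x.2]
    exact le_iSup_of_le ⟨i, by rw [hi]; exact hj⟩ (le_iSup_of_le ⟨j, hi.symm⟩ le_rfl)

/-- The sum of the subspaces placed at the point `y`, for `y` different from the basepoint. -/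
def KU.part (p : KU U X x₀) (y : {y : X // y ≠ x₀}) : Submodule ℂ U :=
  Quot.lift (fun c : PreKU U X x₀ => c.part y.1) (by
    rintro _ _ ⟨α, V, x⟩
    exact PreKU.part_glue α V x y.2) p

theorem KU.part_mk (c : PreKU U X x₀) (y : {y : X // y ≠ x₀}) : (KU.mk c).part y = c.part y :=
  rfl

/-- Gluing along the map that sends an index to the position of its label in `Y`, or to `0` if the
label is the basepoint, gathers equal labels. `Y` may contain unused points, so two configurations
can be brought over the same `Y`. -/
theorem PreKU.exists_normal_form (c : PreKU U X x₀) (Y : Finset X) (h₀ : x₀ ∉ Y)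
    (hY : ∀ i, c.2.2.1 i = x₀ ∨ c.2.2.1 i ∈ Y) :
    ∃ V : OrthTuple U Y.card, (∀ i, V.space i = c.part (Y.equivFin.symm i)) ∧
      KU.mk c = KU.mk ⟨Y.card, V, ⟨Fin.cons x₀ fun i => (Y.equivFin.symm i : X), rfl⟩⟩ := by
  classical
  obtain ⟨k, V, x⟩ := c
  let α : FinBased k Y.card :=
    ⟨fun j => if h : x.1 j ∈ Y then (Y.equivFin ⟨x.1 j, h⟩).succ else 0, by
      simp [x.2, h₀]⟩
  have hα : ∀ (j : Fin (k + 1)) (i : Fin Y.card),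
      α.1 j = i.succ ↔ x.1 j = (Y.equivFin.symm i : X) := by
    intro j i
    by_cases h : x.1 j ∈ Y
    · simp only [α, dif_pos h, Fin.succ_inj]
      rw [← Equiv.eq_symm_apply, Subtype.ext_iff]
    · simp only [α, dif_neg h]
      refine iff_of_false (Fin.succ_ne_zero i).symm fun h' => h ?_
      rw [h']
      exact (Y.equivFin.symm i).2
  refine ⟨V.push α, fun i => ?_, ?_⟩
  · refine le_antisymm (iSup_le fun ⟨j, hj⟩ => ?_) (iSup_le fun ⟨j, hj⟩ => ?_)
    · exact le_iSup_of_le ⟨j, (hα _ _).1 hj⟩ le_rfl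
    · exact le_iSup_of_le ⟨j, (hα _ _).2 hj⟩ le_rfl
  · refine Eq.symm ((Quot.sound (PreKU.Rel.glue α V _)).trans ?_)
    refine congrArg (fun z => KU.mk (⟨k, V, z⟩ : PreKU U X x₀)) (Subtype.ext (funext fun j => ?_))
    by_cases h : x.1 j ∈ Y
    · simp [BasedMap.pull, α, h]
    · simp only [BasedMap.pull, α, Function.comp, dif_neg h, Fin.cons_zero]
      exact ((hY j).resolve_right h).symm

/-- Over a common set of labels the normal forms have the same subspaces, hence coincide. -/
theorem KU.part_injective : Function.Injective (KU.part : KU U X x₀ → _) := by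
  classical
  rintro ⟨c⟩ ⟨c'⟩ h
  let Y : Finset X := (Finset.univ.image c.2.2.1 ∪ Finset.univ.image c'.2.2.1).erase x₀
  have h₀ : x₀ ∉ Y := Finset.notMem_erase _ _
  obtain ⟨V, hV, e⟩ := c.exists_normal_form Y h₀ fun i => by
    by_cases h : c.2.2.1 i = x₀ <;> simp [Y, h]
  obtain ⟨V', hV', e'⟩ := c'.exists_normal_form Y h₀ fun i => by
    by_cases h : c'.2.2.1 i = x₀ <;> simp [Y, h]
  have : V = V' := by
    ext1
    funext i
    rw [hV, hV']
    have hi : (Y.equivFin.symm i : X) ≠ x₀ := fun h => h₀ (h ▸ (Y.equivFin.symm i).2)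
    exact congrFun h ⟨_, hi⟩
  subst this
  exact e.trans e'.symm

theorem PreKU.part_ofFrame {k : ℕ} (m : Fin k → ℕ) (F : BlockSum m →ₗᵢ[ℂ] U)
    (x : BasedMap k X x₀) (y : X) :
    PreKU.part ⟨k, OrthTuple.ofFrame ⟨m, F⟩, x⟩ y =
      Submodule.span ℂ {v | ∃ a : Σ i, Fin (m i), x.1 a.1.succ = y ∧ F (blockBasis m a) = v} := by
  refine le_antisymm (iSup_le fun ⟨i, hi⟩ => ?_) (Submodule.span_le.2 ?_)
  · rw [OrthTuple.ofFrame_space]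
    refine Submodule.span_mono ?_
    rintro _ ⟨l, rfl⟩
    exact ⟨⟨i, l⟩, hi, rfl⟩
  · rintro _ ⟨⟨i, l⟩, hi, rfl⟩
    refine Submodule.mem_iSup_of_mem ⟨i, hi⟩ ?_
    rw [OrthTuple.ofFrame_space]
    exact Submodule.subset_span ⟨l, rfl⟩

theorem PreKU.rank_ofFrame {k : ℕ} (m : Fin k → ℕ) (F : BlockSum m →ₗᵢ[ℂ] U)
    (x : BasedMap k X x₀) :
    PreKU.rank U ⟨k, OrthTuple.ofFrame ⟨m, F⟩, x⟩ =
      open Classical in ∑ i with x.1 (Fin.succ i) ≠ x₀, m i :=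
  Finset.sum_congr rfl fun i _ => OrthTuple.finrank_ofFrame_space m F i

/-- The dimension of the sum of all subspaces placed outside of the basepoint. -/
noncomputable def KU.rank (p : KU U X x₀) : ℕ := Module.finrank ℂ (⨆ y, p.part y : Submodule ℂ U)

/-- The frame vectors labelled away from the basepoint form a basis of the sum of the parts, so the
dimension counts them. -/
theorem KU.rank_mk_ofFrame {k : ℕ} (m : Fin k → ℕ) (F : BlockSum m →ₗᵢ[ℂ] U)
    (x : BasedMap k X x₀) :
    (KU.mk (⟨k, OrthTuple.ofFrame ⟨m, F⟩, x⟩ : PreKU U X x₀)).rank =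
      open Classical in ∑ i with x.1 (Fin.succ i) ≠ x₀, m i := by
  classical
  let v : {a : Σ i, Fin (m i) // x.1 a.1.succ ≠ x₀} → U :=
    fun a => F (blockBasis m a.1)
  have hv : LinearIndependent ℂ v :=
    (((blockBasis m).orthonormal.comp_linearIsometry F).comp _
      Subtype.val_injective).linearIndependent
  have h : (⨆ y, (KU.mk (⟨k, OrthTuple.ofFrame ⟨m, F⟩, x⟩ : PreKU U X x₀)).part y) =
      Submodule.span ℂ (Set.range v) := by
    simp only [KU.part_mk, PreKU.part_ofFrame]
    rw [← Submodule.span_iUnion]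
    congr 1
    ext w
    simp only [Set.mem_iUnion, Set.mem_ofPred_eq, Set.mem_range]
    constructor
    · rintro ⟨⟨y, hy⟩, a, rfl, rfl⟩
      exact ⟨⟨a, hy⟩, rfl⟩
    · rintro ⟨⟨a, ha⟩, rfl⟩
      exact ⟨⟨_, ha⟩, a, rfl, rfl⟩
  rw [KU.rank, h, finrank_span_eq_card hv]
  let e : {a : Σ i, Fin (m i) // x.1 a.1.succ ≠ x₀} ≃
      Σ i : {i : Fin k // x.1 i.succ ≠ x₀}, Fin (m i) :=
    { toFun := fun a => ⟨⟨a.1.1, a.2⟩, a.1.2⟩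
      invFun := fun a => ⟨⟨a.1.1, a.2⟩, a.1.2⟩ }
  rw [Fintype.card_congr e, Fintype.card_sigma]
  simp only [Fintype.card_fin]
  rw [← Finset.sum_subtype_eq_sum_filter, ← Finset.subtype_univ]

theorem KU.rank_mk (c : PreKU U X x₀) : (KU.mk c).rank = c.rank := by
  obtain ⟨k, V, x⟩ := c
  obtain ⟨⟨m, F⟩, rfl⟩ := OrthTuple.ofFrame_surjective k V
  exact (KU.rank_mk_ofFrame m F x).trans (PreKU.rank_ofFrame m F x).symm

/-- The filtration asks for some representative of small rank; as the rank depends only on the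
class, every representative can be used. -/
theorem mem_rankFiltration_iff {p : KU U X x₀} {s : ℤ} :
    p ∈ rankFiltration U X x₀ s ↔ (p.rank : ℤ) ≤ s := by
  constructor
  · rintro ⟨c, rfl, h⟩
    rwa [KU.rank_mk]
  · obtain ⟨c⟩ := p
    intro h
    exact ⟨c, rfl, by rwa [← KU.rank_mk]⟩

end Parts

/-! ## The topology of spaces of isometric embeddings -/

section IsometryTopology

variable {V V' W : Type} [NormedAddCommGroup V] [InnerProductSpace ℂ V]
  [NormedAddCommGroup V'] [InnerProductSpace ℂ V']
  [NormedAddCommGroup W] [InnerProductSpace ℂ W]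

/-- Precomposition with an isometric embedding. -/
def IsoEmb.precomp (f : IsoEmb V W) (e : V' →ₗᵢ[ℂ] V) : IsoEmb V' W :=
  LinearIsometry.comp (σ₁₂ := RingHom.id ℂ) (σ₂₃ := RingHom.id ℂ) f e

variable (V W) in
/-- The set `L(V,W)` with the Stiefel topology. -/
def StiefelEmb : Type := V →ₗᵢ[ℂ] W

instance : TopologicalSpace (StiefelEmb V W) := stiefelTopology V W

/-- Evaluation of an isometric embedding at a vector. -/
def StiefelEmb.eval (v : V) (f : StiefelEmb V W) : W := (show V →ₗᵢ[ℂ] W from f) v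

theorem StiefelEmb.continuous_eval (v : V) : Continuous (StiefelEmb.eval v : StiefelEmb V W → W) :=
  (continuous_apply v).comp continuous_induced_dom

theorem StiefelEmb.continuous_iff {T : Type} [TopologicalSpace T] {h : T → StiefelEmb V W} :
    Continuous h ↔ ∀ v, Continuous fun t => (h t).eval v :=
  continuous_induced_rng.trans continuous_pi_iff

/-- Precomposition with an isometric embedding. -/
def StiefelEmb.precomp (f : StiefelEmb V W) (e : V' →ₗᵢ[ℂ] V) : StiefelEmb V' W :=
  LinearIsometry.comp (σ₁₂ := RingHom.id ℂ) (σ₂₃ := RingHom.id ℂ) f e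

/-- The inclusions `L(V,W') → L(V,W)`, for the finite dimensional subspaces `W'` of `W`. -/
def IsoEmb.ofStiefel (f : Σ W' : {W' : Submodule ℂ W // FiniteDimensional ℂ W'},
    StiefelEmb V W'.1) : IsoEmb V W :=
  LinearIsometry.comp (σ₁₂ := RingHom.id ℂ) (σ₂₃ := RingHom.id ℂ) f.1.1.subtypeₗᵢ f.2

/-- Surjectivity holds because an embedding of a finite dimensional space factors through its finite
dimensional range. -/
theorem IsoEmb.isQuotientMap_ofStiefel [FiniteDimensional ℂ V] :
    IsQuotientMap (IsoEmb.ofStiefel : _ → IsoEmb V W) := by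
  refine ⟨⟨?_⟩, fun f => ?_⟩
  · simp only [instTopologicalSpaceSigma, coinduced_iSup, coinduced_compose]
    rfl
  · change V →ₗᵢ[ℂ] W at f
    refine ⟨⟨⟨LinearMap.range f.toLinearMap, inferInstance⟩,
      ⟨f.toLinearMap.rangeRestrict, fun v => f.norm_map v⟩⟩, rfl⟩

theorem IsoEmb.continuous_precomp [FiniteDimensional ℂ V] (e : V' →ₗᵢ[ℂ] V) :
    Continuous fun f : IsoEmb V W => f.precomp e := by
  have : FiniteDimensional ℂ V' := FiniteDimensional.of_injective e.toLinearMap e.injective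
  refine IsoEmb.isQuotientMap_ofStiefel.continuous_iff.2 (continuous_sigma fun W' => ?_)
  have h : Continuous fun f : StiefelEmb V W'.1 => f.precomp e :=
    StiefelEmb.continuous_iff.2 fun v => StiefelEmb.continuous_eval (e v)
  exact IsoEmb.isQuotientMap_ofStiefel.continuous.comp (continuous_sigmaMk.comp h)

theorem unitaryIso_apply {s : ℕ} (g : Matrix.unitaryGroup (Fin s) ℂ)
    (v : EuclideanSpace ℂ (Fin s)) : unitaryIso g v = Matrix.toEuclideanLin g.1 v := rfl

theorem unitaryIso_single {s : ℕ} (g : Matrix.unitaryGroup (Fin s) ℂ) (j : Fin s) :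
    unitaryIso g (EuclideanSpace.single j 1) =
      ∑ l, g.1 l j • EuclideanSpace.single l (1 : ℂ) := by
  ext i
  simp [unitaryIso_apply, Matrix.toLpLin_apply, Pi.single_apply]

theorem continuous_unitaryIso (s : ℕ) (v : EuclideanSpace ℂ (Fin s)) :
    Continuous fun g : Matrix.unitaryGroup (Fin s) ℂ => unitaryIso g v := by
  have h : Continuous fun g : Matrix.unitaryGroup (Fin s) ℂ => g.1 := continuous_subtype_val
  exact (PiLp.continuous_toLp 2 _).comp (h.matrix_mulVec continuous_const)

theorem isCompact_unitaryGroup (s : ℕ) :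
    IsCompact (Matrix.unitaryGroup (Fin s) ℂ : Set (Matrix (Fin s) (Fin s) ℂ)) := by
  have h : IsCompact (Set.pi Set.univ fun _ => Set.pi Set.univ fun _ => Metric.closedBall 0 1 :
      Set (Fin s → Fin s → ℂ)) :=
    isCompact_univ_pi fun _ => isCompact_univ_pi fun _ => isCompact_closedBall _ _
  refine IsCompact.of_isClosed_subset (X := Matrix (Fin s) (Fin s) ℂ) h ?_ fun U hU i _ j _ => ?_
  · have : (Matrix.unitaryGroup (Fin s) ℂ : Set (Matrix (Fin s) (Fin s) ℂ)) =
        {A | A * star A = 1} := by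
      ext A
      exact Matrix.mem_unitaryGroup_iff
    rw [this]
    exact isClosed_eq (by fun_prop) continuous_const
  · simpa using entry_norm_bound_of_unitary hU i j

instance (s : ℕ) : CompactSpace (Matrix.unitaryGroup (Fin s) ℂ) :=
  isCompact_iff_compactSpace.1 (isCompact_unitaryGroup s)

/-- Joint continuity can be checked on the Stiefel pieces since `U(s)` is locally compact, so that
the product with it preserves the quotient map from the disjoint union of these pieces. -/
theorem continuous_isoEmb_precomp_unitaryIso (s : ℕ) :
    Continuous fun p : Matrix.unitaryGroup (Fin s) ℂ × IsoEmb (EuclideanSpace ℂ (Fin s)) W =>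
      p.2.precomp (unitaryIso p.1) := by
  refine IsoEmb.isQuotientMap_ofStiefel.continuous_lift_prod_right ?_
  let E := EuclideanSpace ℂ (Fin s)
  let G := Matrix.unitaryGroup (Fin s) ℂ
  have h : ∀ W' : {W' : Submodule ℂ W // FiniteDimensional ℂ W'},
      Continuous fun p : StiefelEmb E W'.1 × G => p.1.precomp (unitaryIso p.2) := by
    intro W'
    refine StiefelEmb.continuous_iff.2 fun v => ?_
    -- Expanding in the standard basis separates the two variables: coefficients depend on the
    -- matrix only, vectors on the embedding only.
    have e : ∀ p : StiefelEmb E W'.1 × G, (p.1.precomp (unitaryIso p.2)).eval v =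
        ∑ i, (unitaryIso p.2 v) i • p.1.eval (EuclideanSpace.single i 1) := by
      intro p
      have h1 : unitaryIso p.2 v = ∑ i, (unitaryIso p.2 v) i • EuclideanSpace.single i (1 : ℂ) := by
        ext i
        simp [Pi.single_apply]
      change (show E →ₗᵢ[ℂ] W'.1 from p.1) (unitaryIso p.2 v) = _
      conv_lhs => rw [h1]
      rw [map_sum]
      exact Finset.sum_congr rfl fun i _ => LinearIsometry.map_smul (show E →ₗᵢ[ℂ] W'.1 from p.1) _ _
    simp only [e]
    refine continuous_finsetSum _ fun i _ => ?_
    have h1 : Continuous fun p : StiefelEmb E W'.1 × G => (unitaryIso p.2 v) i :=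
      ((PiLp.continuous_apply 2 _ i).comp (continuous_unitaryIso s v)).comp continuous_snd
    have h2 : Continuous fun p : StiefelEmb E W'.1 × G =>
        p.1.eval (EuclideanSpace.single i (1 : ℂ)) :=
      (StiefelEmb.continuous_eval _).comp continuous_fst
    exact h1.smul h2
  have h' : Continuous fun q : (Σ W' : {W' : Submodule ℂ W // FiniteDimensional ℂ W'},
      StiefelEmb E W'.1 × G) => IsoEmb.ofStiefel ⟨q.1, q.2.1.precomp (unitaryIso q.2.2)⟩ :=
    IsoEmb.isQuotientMap_ofStiefel.continuous.comp
      (continuous_sigma fun W' => continuous_sigmaMk.comp (h W'))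
  exact (h'.comp Homeomorph.sigmaProdDistrib.continuous).comp continuous_swap

end IsometryTopology

/-! ## Diagonal tuples of matrices -/

/-- A map into a one-point compactification which is continuous and proper on an open subset, and
sends the complement to infinity, is continuous. -/
theorem continuous_onePoint_of_isOpenEmbedding {Z T Y : Type} [TopologicalSpace Z]
    [TopologicalSpace T] [T2Space T] [TopologicalSpace Y] {j : Z → T} (hj : IsOpenEmbedding j)
    {p : Z → Y} (hp : Continuous p) (hK : ∀ K, IsClosed K → IsCompact K → IsCompact (p ⁻¹' K))
    {F : T → OnePoint Y} (hF : ∀ z, F (j z) = p z)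
    (hF' : ∀ t, t ∉ Set.range j → F t = OnePoint.infty) : Continuous F := by
  have key : ∀ S : Set Y, F ⁻¹' ((↑) '' S) = j '' (p ⁻¹' S) := by
    intro S
    ext t
    by_cases ht : t ∈ Set.range j
    · obtain ⟨z, rfl⟩ := ht
      simp [hF, hj.injective.eq_iff]
    · refine iff_of_false (fun h => ?_) fun ⟨z, _, hz⟩ => ht ⟨z, hz⟩
      obtain ⟨y, _, hy⟩ := h
      rw [hF' t ht] at hy
      exact OnePoint.coe_ne_infty y hy
  refine continuous_def.2 fun S hS => ?_
  by_cases h : OnePoint.infty ∈ S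
  · obtain ⟨h1, h2⟩ := (OnePoint.isOpen_iff_of_mem h).1 hS
    -- For a neighbourhood of infinity, the complement of the preimage is the `j`-image of a compact
    -- set, hence closed in the Hausdorff space `T`.
    have e : (F ⁻¹' S)ᶜ = j '' (p ⁻¹' ((↑) ⁻¹' S : Set Y)ᶜ) := by
      rw [← key, ← Set.preimage_compl]
      congr 1
      ext x
      induction x using OnePoint.rec <;> simp [h]
    rw [← isClosed_compl_iff, e]
    exact ((hK _ h1 h2).image hj.continuous).isClosed
  · have e : F ⁻¹' S = j '' (p ⁻¹' ((↑) ⁻¹' S : Set Y)) := by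
      rw [← key]
      congr 1
      ext x
      induction x using OnePoint.rec <;> simp [h]
    rw [e]
    exact hj.isOpenMap _ (hp.isOpen_preimage _ ((OnePoint.isOpen_iff_of_notMem h).1 hS))

namespace CommVar

variable {n s : ℕ}

/-- The commuting tuple of diagonal matrices with joint eigenvalues `√-1 x_j`. -/
noncomputable def diag (x : Fin s → Fin n → ℝ) : CommVar n s :=
  ⟨fun i => Matrix.diagonal fun j => Complex.I * x j i, fun i => by
    rw [Matrix.diagonal_conjTranspose, Matrix.diagonal_neg]
    congr 1
    ext j
    simp, fun i j => by
    rw [Matrix.diagonal_mul_diagonal, Matrix.diagonal_mul_diagonal]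
    simp only [mul_comm]⟩

theorem continuous_val : Continuous fun X : CommVar n s => X.1 := continuous_subtype_val

theorem continuous_iff {T : Type} [TopologicalSpace T] {h : T → CommVar n s} :
    Continuous h ↔ ∀ i, Continuous fun t => (h t).1 i :=
  continuous_induced_rng.trans continuous_pi_iff

theorem conj_inv_conj (g : Matrix.unitaryGroup (Fin s) ℂ) (X : CommVar n s) :
    conj g⁻¹ (conj g X) = X := by
  have hg : (g⁻¹).1 * g.1 = 1 := by
    rw [← Submonoid.coe_mul, inv_mul_cancel, Submonoid.coe_one]
  refine Subtype.ext (funext fun i => ?_)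
  change (g⁻¹).1 * (g.1 * X.1 i * (g⁻¹).1) * (g⁻¹⁻¹).1 = X.1 i
  rw [inv_inv]
  calc _ = ((g⁻¹).1 * g.1) * X.1 i * ((g⁻¹).1 * g.1) := by noncomm_ring
    _ = _ := by rw [hg, one_mul, mul_one]

theorem continuous_conj :
    Continuous fun p : Matrix.unitaryGroup (Fin s) ℂ × CommVar n s => conj p.1 p.2 := by
  refine continuous_iff.2 fun i => ?_
  have h1 : Continuous fun p : Matrix.unitaryGroup (Fin s) ℂ × CommVar n s => p.1.1 :=
    continuous_subtype_val.comp continuous_fst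
  have h2 : Continuous fun p : Matrix.unitaryGroup (Fin s) ℂ × CommVar n s => p.2.1 i :=
    (continuous_apply i).comp (continuous_val.comp continuous_snd)
  exact (h1.mul h2).mul h1.star

theorem continuous_diag : Continuous (diag : (Fin s → Fin n → ℝ) → CommVar n s) := by
  refine continuous_iff.2 fun i => Continuous.matrix_diagonal ?_
  fun_prop

theorem im_diag_apply (x : Fin s → Fin n → ℝ) (j : Fin s) (i : Fin n) :
    (((diag x).1 i) j j).im = x j i := by
  simp [diag]

instance : T2Space (CommVar n s) :=
  inferInstanceAs (T2Space {X : Fin n → Matrix (Fin s) (Fin s) ℂ //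
    (∀ i, (X i).conjTranspose = -X i) ∧ ∀ i j, X i * X j = X j * X i})

instance : LocallyCompactSpace (CommVar n s) := by
  have h : IsClosed {X : Fin n → Matrix (Fin s) (Fin s) ℂ |
      (∀ i, (X i).conjTranspose = -X i) ∧ ∀ i j, X i * X j = X j * X i} := by
    simp only [Set.ofPred_and, Set.ofPred_forall]
    refine IsClosed.inter (isClosed_iInter fun i => ?_)
      (isClosed_iInter fun i => isClosed_iInter fun j => ?_)
    · exact isClosed_eq (continuous_apply i).matrix_conjTranspose (continuous_apply i).neg
    · exact isClosed_eq ((continuous_apply i).mul (continuous_apply j))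
        ((continuous_apply j).mul (continuous_apply i))
  have : LocallyCompactSpace (Fin n → Matrix (Fin s) (Fin s) ℂ) :=
    inferInstanceAs (LocallyCompactSpace (Fin n → Fin s → Fin s → ℂ))
  exact h.locallyCompactSpace

/-- The commuting tuple with joint eigenvalues `√-1 x_j` and a given eigenbasis, extended to
infinite values of `x`. -/
noncomputable def conjDiagPlus (g : Matrix.unitaryGroup (Fin s) ℂ) (x : Fin s → Sph n) :
    OnePoint (CommVar n s) :=
  open Classical in
  if ∃ j, x j = OnePoint.infty then OnePoint.infty
  else ((conj g (diag fun j => (x j).elim 0 id) : CommVar n s) : OnePoint (CommVar n s))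

theorem conjDiagPlus_coe (g : Matrix.unitaryGroup (Fin s) ℂ) (x : Fin s → Fin n → ℝ) :
    conjDiagPlus g (fun j => (x j : Sph n)) = (conj g (diag x) : CommVar n s) := by
  simp [conjDiagPlus]

theorem conjDiagPlus_of_exists (g : Matrix.unitaryGroup (Fin s) ℂ) {x : Fin s → Sph n}
    (h : ∃ j, x j = OnePoint.infty) : conjDiagPlus g x = OnePoint.infty := if_pos h

theorem continuous_conj_diag :
    Continuous fun p : Matrix.unitaryGroup (Fin s) ℂ × (Fin s → Fin n → ℝ) =>
      (conj p.1 (diag p.2) : CommVar n s) :=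
  Continuous.comp (g := fun q : Matrix.unitaryGroup (Fin s) ℂ × CommVar n s => conj q.1 q.2)
    (f := fun p : Matrix.unitaryGroup (Fin s) ℂ × (Fin s → Fin n → ℝ) => (p.1, diag p.2))
    continuous_conj (continuous_fst.prodMk (continuous_diag.comp continuous_snd))

/-- The labels are recovered continuously from `g` and `g·diag(x)·g⁻¹`, as imaginary parts of the
diagonal entries after conjugating back. So the preimage is a closed subset of a continuous image of
the compact `U(s) × K`. -/
theorem isCompact_preimage_conj_diag {K : Set (CommVar n s)} (hK : IsClosed K)
    (hK' : IsCompact K) :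
    IsCompact ((fun p : Matrix.unitaryGroup (Fin s) ℂ × (Fin s → Fin n → ℝ) =>
      (conj p.1 (diag p.2) : CommVar n s)) ⁻¹' K) := by
  let r : Matrix.unitaryGroup (Fin s) ℂ × CommVar n s →
      Matrix.unitaryGroup (Fin s) ℂ × (Fin s → Fin n → ℝ) :=
    fun q => (q.1, fun l i => ((conj q.1⁻¹ q.2).1 i l l).im)
  have hr : Continuous r := by
    refine continuous_fst.prodMk (continuous_pi fun l => continuous_pi fun i => ?_)
    have h1 : Continuous fun q : Matrix.unitaryGroup (Fin s) ℂ × CommVar n s =>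
        (conj q.1⁻¹ q.2 : CommVar n s) :=
      Continuous.comp (g := fun q : Matrix.unitaryGroup (Fin s) ℂ × CommVar n s => conj q.1 q.2)
        (f := fun q : Matrix.unitaryGroup (Fin s) ℂ × CommVar n s => (q.1⁻¹, q.2))
        continuous_conj (continuous_fst.inv.prodMk continuous_snd)
    have h2 := (continuous_apply i).comp (continuous_val.comp h1)
    exact Complex.continuous_im.comp (h2.matrix_elem l l)
  refine ((isCompact_univ.prod hK').image hr).of_isClosed_subset
    (hK.preimage continuous_conj_diag) ?_
  rintro ⟨g, x⟩ h
  refine ⟨(g, conj g (diag x)), ⟨trivial, h⟩, Prod.ext rfl (funext fun l => funext fun i => ?_)⟩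
  change ((conj g⁻¹ (conj g (diag x))).1 i l l).im = x l i
  rw [conj_inv_conj, im_diag_apply]

theorem isOpenEmbedding_coe_sph :
    IsOpenEmbedding (Pi.map fun _ => (↑) : (Fin s → Fin n → ℝ) → (Fin s → Sph n)) :=
  IsOpenEmbedding.piMap fun _ => OnePoint.isOpenEmbedding_coe

theorem continuous_conjDiagPlus :
    Continuous fun p : Matrix.unitaryGroup (Fin s) ℂ × (Fin s → Sph n) =>
      (conjDiagPlus p.1 p.2 : OnePoint (CommVar n s)) := by
  refine continuous_onePoint_of_isOpenEmbedding (IsOpenEmbedding.id.prodMap isOpenEmbedding_coe_sph)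
    continuous_conj_diag (fun _ => isCompact_preimage_conj_diag) ?_ ?_
  · rintro ⟨g, x⟩
    exact conjDiagPlus_coe g x
  · rintro ⟨g, x⟩ h
    refine conjDiagPlus_of_exists g ?_
    by_contra! hx
    choose y hy using fun l => OnePoint.ne_infty_iff_exists.1 (hx l)
    exact h ⟨(g, y), Prod.ext rfl (funext hy)⟩

/-- Commuting skew-Hermitian matrices are simultaneously unitarily diagonalizable. -/
theorem exists_eq_conj_diag (X : CommVar n s) :
    ∃ (g : Matrix.unitaryGroup (Fin s) ℂ) (x : Fin s → Fin n → ℝ), X = conj g (diag x) := by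
  classical
  let E := EuclideanSpace ℂ (Fin s)
  -- Multiplying by `-√-1` turns skew-Hermitian matrices into Hermitian ones, so that the joint
  -- eigenspace decomposition of commuting symmetric operators applies.
  let T : Fin n → E →ₗ[ℂ] E := fun i => Matrix.toEuclideanLin (-Complex.I • X.1 i)
  have hT : ∀ i, (T i).IsSymmetric := fun i => by
    refine Matrix.isSymmetric_toEuclideanLin_iff.2 ?_
    rw [Matrix.IsHermitian, Matrix.conjTranspose_smul, X.2.1 i]
    simp
  have hC : Pairwise (Function.onFun Commute T) := fun i j _ => by
    change T i ∘ₗ T j = T j ∘ₗ T i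
    rw [← Matrix.toLpLin_mul, ← Matrix.toLpLin_mul]
    simp only [Matrix.smul_mul, Matrix.mul_smul, X.2.2 i j]
  have hI := LinearMap.IsSymmetric.directSum_isInternal_of_pairwise_commute hT hC
  have hO := LinearMap.IsSymmetric.orthogonalFamily_iInf_eigenspaces hT
  let A : (Fin n → ℂ) → Submodule ℂ E := fun χ => ⨅ i, Module.End.eigenspace (T i) (χ i)
  -- Only finitely many joint eigenspaces are nonzero; discarding the others gives the finite index
  -- type needed for an adapted orthonormal basis.
  have : Fintype {χ : Fin n → ℂ // A χ ≠ ⊥} :=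
    iSupIndep.fintypeNeBotOfFiniteDimensional hO.independent
  have hI' : DirectSum.IsInternal fun χ : {χ : Fin n → ℂ // A χ ≠ ⊥} => A χ :=
    DirectSum.isInternal_ne_bot_iff.2 hI
  have hO' : OrthogonalFamily ℂ (fun χ : {χ : Fin n → ℂ // A χ ≠ ⊥} => A χ)
      fun χ => (A χ).subtypeₗᵢ := hO.comp Subtype.val_injective
  have hs : Module.finrank ℂ E = s := by simp [E]
  let b : OrthonormalBasis (Fin s) ℂ E := hI'.subordinateOrthonormalBasis hs hO'
  let χ : Fin s → Fin n → ℂ := fun j => (hI'.subordinateOrthonormalBasisIndex hs j hO').1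
  have hb : ∀ j i, T i (b j) = χ j i • b j := fun j i => by
    have := hI'.subordinateOrthonormalBasis_subordinate hs j hO'
    exact Module.End.mem_eigenspace_iff.1 ((Submodule.mem_iInf _).1 this i)
  have hχ : ∀ j i, χ j i = ((χ j i).re : ℂ) := fun j i => by
    have h1 : Module.End.HasEigenvalue (T i) (χ j i) :=
      Module.End.hasEigenvalue_of_hasEigenvector
        ⟨Module.End.mem_eigenspace_iff.2 (hb j i), b.orthonormal.ne_zero j⟩
    exact (Complex.conj_eq_iff_re.1 ((hT i).conj_eigenvalue_eq_self h1)).symm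
  let e := EuclideanSpace.basisFun (Fin s) ℂ
  let g : Matrix.unitaryGroup (Fin s) ℂ :=
    ⟨e.toBasis.toMatrix b, e.toMatrix_orthonormalBasis_mem_unitary b⟩
  have hg : ∀ i j, g.1 i j = b j i := fun i j => rfl
  refine ⟨g, fun j i => (χ j i).re, Subtype.ext (funext fun i => ?_)⟩
  -- The columns of `g` are the joint eigenvectors, so this is the eigenvector equation read column
  -- by column.
  have h1 : X.1 i * g.1 = g.1 * (diag fun j i => (χ j i).re).1 i := by
    ext l j
    have h2 := congrArg (fun v : E => v l) (hb j i)
    have h3 : -Complex.I * (X.1 i * g.1) l j = χ j i * b j l := by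
      refine Eq.trans ?_ h2
      simp only [T, Matrix.mul_apply, hg, map_smul, LinearMap.smul_apply, PiLp.smul_apply,
        smul_eq_mul]
      rfl
    have h4 : (X.1 i * g.1) l j = Complex.I * (χ j i * b j l) := by
      rw [← h3, ← mul_assoc]
      simp
    rw [h4, diag, Matrix.mul_diagonal, ← hχ, hg]
    ring
  have h2 : g.1 * (g⁻¹).1 = 1 := by
    rw [← Submonoid.coe_mul, mul_inv_cancel, Submonoid.coe_one]
  change _ = g.1 * (diag fun j i => (χ j i).re).1 i * (g⁻¹).1
  rw [← h1, mul_assoc, h2, mul_one]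

/-- The map `conjDiagPlus`, extended by a point sent to infinity. -/
noncomputable def conjDiagSum (p : (Matrix.unitaryGroup (Fin s) ℂ × (Fin s → Sph n)) ⊕ Unit) :
    OnePoint (CommVar n s) :=
  Sum.elim (fun p => conjDiagPlus p.1 p.2) (fun _ => OnePoint.infty) p

/-- The added point matters for `s = 0`: there are then no labels that could be infinite, and
nothing else maps to infinity. -/
theorem conjDiagSum_surjective : Function.Surjective (conjDiagSum (n := n) (s := s)) := by
  intro X
  induction X using OnePoint.rec with
  | infty => exact ⟨Sum.inr (), rfl⟩
  | coe X =>
    obtain ⟨g, x, rfl⟩ := exists_eq_conj_diag X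
    exact ⟨Sum.inl (g, fun j => x j), conjDiagPlus_coe g x⟩

/-- The source is compact and the target Hausdorff. Properness, unlike being a quotient map,
survives the product with an arbitrary space, here the frames. -/
theorem isProperMap_conjDiagSum : IsProperMap (conjDiagSum (n := n) (s := s)) :=
  Continuous.isProperMap (continuous_conjDiagPlus.sumElim continuous_const)

end CommVar

/-! ## The half-smash product as a quotient of labelled frames -/

section HalfSmashQuotient

variable {n s : ℕ}

theorem CommVar.conj_one (X : CommVar n s) : CommVar.conj 1 X = X := by
  refine Subtype.ext (funext fun i => ?_)
  simp [CommVar.conj]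

/-- The class of a labelled frame `(x, f)` in the half-smash product. -/
noncomputable def labelledToHalfSmash (t : (Fin s → Sph n) × (Frames n s ⊕ Unit)) :
    HalfSmash n s :=
  Quot.mk _ (CommVar.conjDiagPlus 1 t.1, t.2)

theorem continuous_labelledToHalfSmash : Continuous (labelledToHalfSmash (n := n) (s := s)) := by
  have h : Continuous fun x : Fin s → Sph n => CommVar.conjDiagPlus 1 x :=
    CommVar.continuous_conjDiagPlus.comp (Continuous.prodMk_right 1)
  exact continuous_quot_mk.comp ((h.comp continuous_fst).prodMk continuous_snd)

theorem mk_conjDiagPlus (g : Matrix.unitaryGroup (Fin s) ℂ) (x : Fin s → Sph n)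
    (f : Frames n s) :
    (Quot.mk _ (CommVar.conjDiagPlus g x, Sum.inl f) : HalfSmash n s) =
      labelledToHalfSmash (x, Sum.inl (f.precomp g)) := by
  have h : CommVar.conjDiagPlus g x =
      OnePoint.map (CommVar.conj g) (CommVar.conjDiagPlus 1 x : OnePoint (CommVar n s)) := by
    by_cases h : ∃ j, x j = OnePoint.infty
    · rw [CommVar.conjDiagPlus_of_exists _ h, CommVar.conjDiagPlus_of_exists _ h]
      rfl
    · simp [CommVar.conjDiagPlus, if_neg h, CommVar.conj_one]
  rw [h]
  exact Quot.sound (HalfSmashRel.balance g _ f)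

theorem mk_eq_halfSmash_base {p : PreHalfSmash n s}
    (h : p.1 = OnePoint.infty ∨ p.2 = Sum.inr ()) : Quot.mk _ p = HalfSmash.base n s :=
  Quot.sound (HalfSmashRel.collapse _ _ h (Or.inl rfl))

/-- Absorbing the unitary matrix of a triple `(g, x, f)` into the frame. -/
noncomputable def absorbUnitary :
    ((Matrix.unitaryGroup (Fin s) ℂ × (Fin s → Sph n)) ⊕ Unit) × (Frames n s ⊕ Unit) →
      (Fin s → Sph n) × (Frames n s ⊕ Unit)
  | (Sum.inl (g, x), Sum.inl f) => (x, Sum.inl (f.precomp g))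
  | (Sum.inl (_, x), Sum.inr _) => (x, Sum.inr ())
  | (Sum.inr _, _) => (fun _ => OnePoint.infty, Sum.inr ())

theorem continuous_absorbUnitary : Continuous (absorbUnitary (n := n) (s := s)) := by
  rw [← Homeomorph.sumProdDistrib.symm.comp_continuous_iff', continuous_sum_dom]
  constructor
  · rw [← Homeomorph.prodSumDistrib.symm.comp_continuous_iff', continuous_sum_dom]
    constructor
    · have h := continuous_isoEmb_precomp_unitaryIso (W := SymC n) s
      have h1 : Continuous fun q : (Matrix.unitaryGroup (Fin s) ℂ × (Fin s → Sph n)) ×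
          Frames n s => (q.1.1, q.2) :=
        (continuous_fst.comp continuous_fst).prodMk continuous_snd
      exact (continuous_snd.comp continuous_fst).prodMk (continuous_inl.comp (h.comp h1))
    · exact (continuous_snd.comp continuous_fst).prodMk continuous_const
  · exact continuous_const

/-- The composite with `absorbUnitary` is the quotient map from all triples `(g, x, f)`: replacing
`(g·diag(x)·g⁻¹, f)` by `(diag(x), f ∘ g)` is the balancing relation. If a composite of continuous
maps is a quotient map, so is its last factor. -/
theorem isQuotientMap_labelledToHalfSmash :
    IsQuotientMap (labelledToHalfSmash (n := n) (s := s)) := by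
  have hp : IsProperMap (Prod.map (CommVar.conjDiagSum (n := n) (s := s))
      (id : Frames n s ⊕ Unit → Frames n s ⊕ Unit)) :=
    CommVar.isProperMap_conjDiagSum.prodMap isProperMap_id
  have hq := hp.isClosedMap.isQuotientMap hp.continuous
    (CommVar.conjDiagSum_surjective.prodMap Function.surjective_id)
  have hmk : IsQuotientMap (Quot.mk (HalfSmashRel n s)) := isQuotientMap_quot_mk
  refine IsQuotientMap.of_comp continuous_absorbUnitary continuous_labelledToHalfSmash ?_
  suffices h : labelledToHalfSmash ∘ absorbUnitary = Quot.mk (HalfSmashRel n s) ∘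
      Prod.map CommVar.conjDiagSum id by
    rw [h]
    exact hmk.comp hq
  funext p
  obtain ⟨⟨g, x⟩ | _, f | _⟩ := p
  · exact (mk_conjDiagPlus g x f).symm
  · exact (mk_eq_halfSmash_base (Or.inr rfl)).trans (mk_eq_halfSmash_base (Or.inr rfl)).symm
  · exact (mk_eq_halfSmash_base (Or.inr rfl)).trans (mk_eq_halfSmash_base (Or.inl rfl)).symm
  · exact (mk_eq_halfSmash_base (Or.inr rfl)).trans (mk_eq_halfSmash_base (Or.inl rfl)).symm

end HalfSmashQuotient

/-! ## The subquotients of the rank filtration as quotients of labelled frames -/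

section Lines

variable {U : Type} [NormedAddCommGroup U] [InnerProductSpace ℂ U] {X : Type} {x₀ : X} {s : ℕ}

/-- The identification of `ℂ ⊕ ⋯ ⊕ ℂ` with `ℂ^s`. -/
noncomputable def lineIso (s : ℕ) :
    BlockSum (fun _ : Fin s => 1) →ₗᵢ[ℂ] EuclideanSpace ℂ (Fin s) :=
  isoOfOrthonormal (blockBasis _) (fun a => EuclideanSpace.single a.1 (1 : ℂ)) (by
    have h := (EuclideanSpace.basisFun (Fin s) ℂ).orthonormal.comp
      (fun a : Σ _ : Fin s, Fin 1 => a.1) (fun a b h => Sigma.ext h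
        (by obtain ⟨a, a'⟩ := a; obtain ⟨b, b'⟩ := b; cases h; simp [Subsingleton.elim a' b']))
    simpa [Function.comp_def] using h)

theorem lineIso_apply (s : ℕ) (a : Σ _ : Fin s, Fin 1) :
    lineIso s (blockBasis _ a) = EuclideanSpace.single a.1 1 :=
  isoOfOrthonormal_apply _ _ _ _

variable (x₀) in
/-- The configuration of the lines spanned by the vectors of a frame `f`, at the points `x_j`. -/
noncomputable def lineConfig (x : Fin s → X) (f : IsoEmb (EuclideanSpace ℂ (Fin s)) U) :
    PreKU U X x₀ :=
  ⟨s, OrthTuple.ofFrame ⟨fun _ => 1, f.precomp (lineIso s)⟩, ⟨Fin.cons x₀ x, rfl⟩⟩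

theorem part_lineConfig (x : Fin s → X) (f : EuclideanSpace ℂ (Fin s) →ₗᵢ[ℂ] U) (y : X) :
    (lineConfig x₀ x f).part y =
      Submodule.span ℂ {v | ∃ j, x j = y ∧ f (EuclideanSpace.single j 1) = v} := by
  refine (PreKU.part_ofFrame _ (f.comp (lineIso s)) _ y).trans (congrArg _ ?_)
  ext v
  have hf : ∀ a, (f.comp (lineIso s)) (blockBasis _ a) = f (EuclideanSpace.single a.1 1) :=
    fun a => congrArg f (lineIso_apply s a)
  simp only [hf, Fin.cons_succ]
  exact ⟨fun ⟨a, h⟩ => ⟨a.1, h⟩, fun ⟨j, h⟩ => ⟨⟨j, 0⟩, h⟩⟩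

theorem rank_lineConfig (x : Fin s → X) (f : EuclideanSpace ℂ (Fin s) →ₗᵢ[ℂ] U) :
    (KU.mk (lineConfig x₀ x f)).rank = open Classical in (Finset.univ.filter (x · ≠ x₀)).card := by
  refine (KU.rank_mk_ofFrame _ (f.comp (lineIso s)) _).trans ?_
  rw [Finset.card_eq_sum_ones]
  rfl

theorem rank_lineConfig_le (x : Fin s → X) (f : EuclideanSpace ℂ (Fin s) →ₗᵢ[ℂ] U) :
    (KU.mk (lineConfig x₀ x f)).rank ≤ s := by
  classical
  rw [rank_lineConfig]
  exact (Finset.card_le_univ _).trans_eq (Fintype.card_fin s)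

theorem rank_lineConfig_lt_iff (x : Fin s → X) (f : EuclideanSpace ℂ (Fin s) →ₗᵢ[ℂ] U) :
    (KU.mk (lineConfig x₀ x f)).rank < s ↔ ∃ j, x j = x₀ := by
  classical
  have h := Finset.card_lt_iff_ne_univ (Finset.univ.filter (x · ≠ x₀))
  rw [Fintype.card_fin] at h
  rw [rank_lineConfig, h, Ne, Finset.filter_eq_self]
  simp

/-- Restricting a frame of `ℂ^{m₁} ⊕ ⋯ ⊕ ℂ^{m_k}` to some of the basis vectors. -/
noncomputable def subFrame {k : ℕ} {m : Fin k → ℕ} (ι : Fin s ↪ Σ i, Fin (m i)) :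
    EuclideanSpace ℂ (Fin s) →ₗᵢ[ℂ] BlockSum m :=
  isoOfOrthonormal (EuclideanSpace.basisFun (Fin s) ℂ) (blockBasis m ∘ ι)
    ((blockBasis m).orthonormal.comp ι ι.injective)

theorem subFrame_single {k : ℕ} {m : Fin k → ℕ} (ι : Fin s ↪ Σ i, Fin (m i)) (j : Fin s) :
    subFrame ι (EuclideanSpace.single j 1) = blockBasis m (ι j) := by
  have := isoOfOrthonormal_apply (EuclideanSpace.basisFun (Fin s) ℂ) (blockBasis m ∘ ι)
    ((blockBasis m).orthonormal.comp ι ι.injective) j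
  rwa [EuclideanSpace.basisFun_apply] at this

/-- Each subspace is split into the lines of its frame vectors; the vectors missed by `ι` lie at the
basepoint and contribute to no part. -/
theorem mk_ofFrame_eq_mk_lineConfig {k : ℕ} (m : Fin k → ℕ) (F : BlockSum m →ₗᵢ[ℂ] U)
    (x : BasedMap k X x₀) (ι : Fin s ↪ Σ i, Fin (m i))
    (hι : ∀ a, a ∉ Set.range ι → x.1 a.1.succ = x₀) :
    KU.mk (⟨k, OrthTuple.ofFrame ⟨m, F⟩, x⟩ : PreKU U X x₀) =
      KU.mk (lineConfig x₀ (fun j => x.1 (ι j).1.succ) (F.comp (subFrame ι))) := by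
  refine KU.part_injective (funext fun y => ?_)
  rw [KU.part_mk, KU.part_mk, PreKU.part_ofFrame, part_lineConfig]
  congr 1
  ext v
  have hF : ∀ j, (F.comp (subFrame ι)) (EuclideanSpace.single j 1) = F (blockBasis m (ι j)) :=
    fun j => congrArg F (subFrame_single ι j)
  simp only [hF]
  constructor
  · rintro ⟨a, ha, rfl⟩
    by_cases h : a ∈ Set.range ι
    · obtain ⟨j, rfl⟩ := h
      exact ⟨j, ha, rfl⟩
    · exact absurd (ha.symm.trans (hι a h)) y.2
  · rintro ⟨j, hj, rfl⟩
    exact ⟨ι j, hj, rfl⟩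

theorem exists_embedding_of_rank_eq {k : ℕ} (m : Fin k → ℕ) (F : BlockSum m →ₗᵢ[ℂ] U)
    (x : BasedMap k X x₀)
    (h : (KU.mk (⟨k, OrthTuple.ofFrame ⟨m, F⟩, x⟩ : PreKU U X x₀)).rank = s) :
    ∃ ι : Fin s ↪ Σ i, Fin (m i), ∀ a, a ∉ Set.range ι → x.1 a.1.succ = x₀ := by
  classical
  let S : Finset (Σ i, Fin (m i)) := (Finset.univ.filter fun i => x.1 (Fin.succ i) ≠ x₀).sigma
    fun _ => Finset.univ
  have hS : S.card = s := by
    rw [← h, KU.rank_mk_ofFrame, Finset.card_sigma]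
    simp only [Finset.card_univ, Fintype.card_fin]
  refine ⟨(S.equivFinOfCardEq hS).symm.toEmbedding.trans (Function.Embedding.subtype _),
    fun a ha => ?_⟩
  by_contra hx
  refine ha ⟨S.equivFinOfCardEq hS ⟨a, ?_⟩, ?_⟩
  · simp [S, hx]
  · simp

theorem continuous_lineConfig [TopologicalSpace X] :
    Continuous fun p : (Fin s → X) × IsoEmb (EuclideanSpace ℂ (Fin s)) U =>
      lineConfig x₀ p.1 p.2 := by
  have h1 : Continuous fun f : IsoEmb (EuclideanSpace ℂ (Fin s)) U =>
      (OrthTuple.ofFrame ⟨fun _ => 1, f.precomp (lineIso s)⟩ : OrthTuple U s) :=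
    (continuous_coinduced_rng (f := OrthTuple.ofFrame)).comp
      (continuous_sigmaMk.comp (IsoEmb.continuous_precomp (lineIso s)))
  have h2 : Continuous fun x : Fin s → X => (⟨Fin.cons x₀ x, rfl⟩ : BasedMap s X x₀) := by
    refine Continuous.subtype_mk (continuous_pi fun j => ?_) _
    refine Fin.cases ?_ (fun i => ?_) j
    · exact continuous_const
    · exact continuous_apply i
  exact continuous_sigmaMk.comp ((h1.comp continuous_snd).prodMk (h2.comp continuous_fst))

end Lines

/-! ### Collapsing a subspace to a point. -/

namespace Collapse

variable {X : Type} {A B : Set X}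

/-- The class in `A/B` of a point of `A`. -/
def mk (A B : Set X) (a : A) : Collapse A B := Quot.mk _ (Sum.inl a)

theorem mk_eq_base {a : A} (h : (a : X) ∈ B) : mk A B a = base A B :=
  Quot.sound (CollapseRel.glue a h)

open Classical in
/-- The point of `A \ B` underlying a point of `A/B` different from the basepoint. -/
noncomputable def lift? (p : Collapse A B) : Option X :=
  Quot.lift (Sum.elim (fun a : A => if (a : X) ∈ B then none else some (a : X)) fun _ => none)
    (by
      rintro _ _ ⟨a, ha⟩
      exact if_pos ha) p

open Classical in
theorem lift?_mk (a : A) : lift? (mk A B a) = if (a : X) ∈ B then none else some (a : X) := rfl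

theorem lift?_base : lift? (base A B) = none := rfl

theorem mk_eq_base_iff {a : A} : mk A B a = base A B ↔ (a : X) ∈ B := by
  refine ⟨fun h => ?_, mk_eq_base⟩
  by_contra h'
  have := congrArg lift? h
  rw [lift?_mk, if_neg h', lift?_base] at this
  exact Option.some_ne_none _ this

theorem eq_of_mk_eq {a a' : A} (ha : (a : X) ∉ B) (h : mk A B a = mk A B a') :
    (a : X) = a' := by
  have h' : (a' : X) ∉ B := fun h' => ha (mk_eq_base_iff.1 (h.trans (mk_eq_base h')))
  have := congrArg lift? h
  rwa [lift?_mk, lift?_mk, if_neg ha, if_neg h', Option.some_inj] at this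

/-- Closedness is required in `X` and not just in `A`. For the rank filtration this permits testing
in the quotient topology of `ku(X,U)`, without describing the subspace topology on a filtration
stage. -/
theorem isClosed_of_isClosed [TopologicalSpace X] {Z : Set (Collapse A B)}
    (h : IsClosed {p : X | ∃ hp : p ∈ A, mk A B ⟨p, hp⟩ ∈ Z}) : IsClosed Z := by
  have hq : IsQuotientMap (Quot.mk (CollapseRel A B)) := isQuotientMap_quot_mk
  refine (hq.isClosed_preimage (s := Z)).1 (isClosed_sum_iff.2 ⟨?_, isClosed_discrete _⟩)
  convert h.preimage continuous_subtype_val using 1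
  ext a
  exact ⟨fun h => ⟨a.2, h⟩, fun h => h.2⟩

end Collapse

/-! ### The quotient map from labelled frames to the rank subquotient. -/

section RankQuotient

variable {U : Type} [NormedAddCommGroup U] [InnerProductSpace ℂ U] {X : Type} {x₀ : X} {s : ℕ}

/-- Besides the coend projection, the quotient map `OrthTuple.ofFrame` must be multiplied by
`Map_*(⟨k⟩, X)`; it remains a quotient map since this space is locally compact for compact Hausdorff
`X`. -/
theorem isClosed_ku_of_isClosed [TopologicalSpace X] [CompactSpace X] [T2Space X]
    {Z : Set (KU U X x₀)}
    (h : ∀ (k : ℕ) (m : Fin k → ℕ), IsClosed {p : IsoEmb (BlockSum m) U × BasedMap k X x₀ |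
      KU.mk ⟨k, OrthTuple.ofFrame ⟨m, p.1⟩, p.2⟩ ∈ Z}) : IsClosed Z := by
  have hq : IsQuotientMap (Quot.mk (PreKU.Rel U X x₀)) := isQuotientMap_quot_mk
  refine (hq.isClosed_preimage (s := Z)).1 (isClosed_sigma_iff.2 fun k => ?_)
  have hB : IsClosed {x : Fin (k + 1) → X | x 0 = x₀} :=
    isClosed_eq (continuous_apply 0) continuous_const
  have : LocallyCompactSpace (BasedMap k X x₀) := hB.locallyCompactSpace
  have hf : IsQuotientMap (OrthTuple.ofFrame : _ → OrthTuple U k) :=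
    ⟨⟨rfl⟩, OrthTuple.ofFrame_surjective k⟩
  -- Openness of the complement is phrased as continuity of a `Prop`-valued map, to which the
  -- lifting lemma for products applies.
  have hc : Continuous fun p : OrthTuple U k × BasedMap k X x₀ =>
      KU.mk (⟨k, p⟩ : PreKU U X x₀) ∉ Z := by
    refine hf.continuous_lift_prod_left ?_
    rw [← Homeomorph.sigmaProdDistrib.symm.comp_continuous_iff', continuous_sigma_iff]
    intro m
    exact continuous_Prop.2 (h k m).isOpen_compl
  exact isOpen_compl_iff.1 (continuous_Prop.1 hc)

variable (U x₀) in
/-- The class of a labelled frame in the subquotient of the rank filtration. -/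
noncomputable def labelledToSubquotient
    (t : (Fin s → X) × (IsoEmb (EuclideanSpace ℂ (Fin s)) U ⊕ Unit)) :
    Collapse (rankFiltration U X x₀ (s : ℤ)) (rankFiltration U X x₀ ((s : ℤ) - 1)) :=
  Sum.elim (fun f => Collapse.mk _ _ ⟨KU.mk (lineConfig x₀ t.1 f),
    mem_rankFiltration_iff.2 (Nat.cast_le.2 (rank_lineConfig_le t.1 f))⟩)
    (fun _ => Collapse.base _ _) t.2

theorem mem_rankFiltration_sub_one_iff {p : KU U X x₀} :
    p ∈ rankFiltration U X x₀ ((s : ℤ) - 1) ↔ p.rank < s := by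
  rw [mem_rankFiltration_iff]
  omega

theorem mk_lineConfig_mem_iff (x : Fin s → X) (f : EuclideanSpace ℂ (Fin s) →ₗᵢ[ℂ] U) :
    KU.mk (lineConfig x₀ x f) ∈ rankFiltration U X x₀ ((s : ℤ) - 1) ↔ ∃ j, x j = x₀ :=
  mem_rankFiltration_sub_one_iff.trans (rank_lineConfig_lt_iff x f)

theorem continuous_labelledToSubquotient [TopologicalSpace X] :
    Continuous (labelledToSubquotient U x₀ (s := s)) := by
  rw [← Homeomorph.prodSumDistrib.symm.comp_continuous_iff', continuous_sum_dom]
  refine ⟨?_, continuous_const⟩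
  have h : Continuous fun p : (Fin s → X) × IsoEmb (EuclideanSpace ℂ (Fin s)) U =>
      (⟨KU.mk (lineConfig x₀ p.1 p.2), mem_rankFiltration_iff.2
        (Nat.cast_le.2 (rank_lineConfig_le p.1 p.2))⟩ : rankFiltration U X x₀ (s : ℤ)) :=
    (continuous_quot_mk.comp continuous_lineConfig).subtype_mk _
  exact continuous_quot_mk.comp (continuous_inl.comp h)

theorem labelledToSubquotient_surjective [Nonempty X] :
    Function.Surjective (labelledToSubquotient U x₀ (s := s)) := by
  obtain ⟨y⟩ := ‹Nonempty X›
  rintro ⟨⟨⟨p, hp⟩⟩ | _⟩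
  · by_cases h : p ∈ rankFiltration U X x₀ ((s : ℤ) - 1)
    · exact ⟨(fun _ => y, Sum.inr ()), (Collapse.mk_eq_base h).symm⟩
    · obtain ⟨k, V, x⟩ := p
      obtain ⟨⟨m, F⟩, rfl⟩ := OrthTuple.ofFrame_surjective k V
      have h1 := mem_rankFiltration_iff.1 hp
      have h2 := mem_rankFiltration_sub_one_iff.not.1 h
      obtain ⟨ι, hι⟩ := exists_embedding_of_rank_eq (s := s) m F x
        (le_antisymm (Nat.cast_le.1 h1) (not_lt.1 h2))
      refine ⟨(fun j => x.1 (ι j).1.succ, Sum.inl (IsoEmb.precomp F (subFrame ι))), ?_⟩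
      exact congrArg (Collapse.mk _ _) (Subtype.ext (mk_ofFrame_eq_mk_lineConfig m F x ι hι).symm)
  · exact ⟨(fun _ => y, Sum.inr ()), rfl⟩

theorem collapse_mk_ofFrame {k : ℕ} (m : Fin k → ℕ) (F : BlockSum m →ₗᵢ[ℂ] U)
    (x : BasedMap k X x₀) (ι : Fin s ↪ Σ i, Fin (m i))
    (hι : ∀ a, a ∉ Set.range ι → x.1 a.1.succ = x₀)
    (hp : KU.mk (⟨k, OrthTuple.ofFrame ⟨m, F⟩, x⟩ : PreKU U X x₀) ∈
      rankFiltration U X x₀ (s : ℤ)) :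
    Collapse.mk _ (rankFiltration U X x₀ ((s : ℤ) - 1)) ⟨_, hp⟩ =
      labelledToSubquotient U x₀
        (fun j => x.1 (ι j).1.succ, Sum.inl (IsoEmb.precomp F (subFrame ι))) :=
  congrArg (Collapse.mk _ _) (Subtype.ext (mk_ofFrame_eq_mk_lineConfig m F x ι hι))

/-- The exact rank is not a closed condition, so neither alternative prescribes it: `ι` and `I` only
force the labels outside them to be the basepoint. If a vector selected by `ι` also sits at the
basepoint, both descriptions give the basepoint of the subquotient. The second alternative is needed
because `ι` does not exist when the total dimension is less than `s`. -/
theorem exists_collapse_mk_mem_iff {k : ℕ} (m : Fin k → ℕ) (F : BlockSum m →ₗᵢ[ℂ] U)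
    (x : BasedMap k X x₀) (Z : Set (Collapse (rankFiltration U X x₀ (s : ℤ))
      (rankFiltration U X x₀ ((s : ℤ) - 1)))) :
    (∃ hp : KU.mk (⟨k, OrthTuple.ofFrame ⟨m, F⟩, x⟩ : PreKU U X x₀) ∈
        rankFiltration U X x₀ (s : ℤ), Collapse.mk _ _ ⟨_, hp⟩ ∈ Z) ↔
      (∃ ι : Fin s ↪ Σ i, Fin (m i), (∀ a, a ∉ Set.range ι → x.1 a.1.succ = x₀) ∧
        labelledToSubquotient U x₀
          (fun j => x.1 (ι j).1.succ, Sum.inl (IsoEmb.precomp F (subFrame ι))) ∈ Z) ∨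
      ∃ I : {I : Finset (Fin k) // ∑ i ∈ I, m i < s},
        (∀ i, i ∉ I.1 → x.1 (Fin.succ i) = x₀) ∧ Collapse.base _ _ ∈ Z := by
  classical
  constructor
  · rintro ⟨hp, hZ⟩
    by_cases h' : (KU.mk (⟨k, OrthTuple.ofFrame ⟨m, F⟩, x⟩ : PreKU U X x₀)).rank < s
    · have hB := mem_rankFiltration_sub_one_iff.2 h'
      rw [Collapse.mk_eq_base (a := ⟨_, hp⟩) hB] at hZ
      rw [KU.rank_mk_ofFrame] at h'
      -- `I` is the set of all indices with label different from the basepoint, as dictated by `h'`.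
      refine Or.inr ⟨⟨_, h'⟩, fun i hi => ?_, hZ⟩
      simpa using hi
    · obtain ⟨ι, hι⟩ := exists_embedding_of_rank_eq (s := s) m F x
        (le_antisymm (Nat.cast_le.1 (mem_rankFiltration_iff.1 hp)) (not_lt.1 h'))
      rw [collapse_mk_ofFrame m F x ι hι hp] at hZ
      exact Or.inl ⟨ι, hι, hZ⟩
  · rintro (⟨ι, hι, hZ⟩ | ⟨⟨I, hI⟩, hx, hZ⟩)
    · have hp : KU.mk (⟨k, OrthTuple.ofFrame ⟨m, F⟩, x⟩ : PreKU U X x₀) ∈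
          rankFiltration U X x₀ (s : ℤ) := by
        rw [mk_ofFrame_eq_mk_lineConfig m F x ι hι]
        exact mem_rankFiltration_iff.2 (Nat.cast_le.2 (rank_lineConfig_le _ _))
      refine ⟨hp, ?_⟩
      rwa [collapse_mk_ofFrame m F x ι hι hp]
    · have h' : (KU.mk (⟨k, OrthTuple.ofFrame ⟨m, F⟩, x⟩ : PreKU U X x₀)).rank < s := by
        rw [KU.rank_mk_ofFrame]
        refine (Finset.sum_le_sum_of_subset fun i hi => ?_).trans_lt hI
        by_contra h
        simp [hx i h] at hi
      have hp := mem_rankFiltration_iff.2 (Nat.cast_le.2 h'.le)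
      have hB := mem_rankFiltration_sub_one_iff.2 h'
      refine ⟨hp, ?_⟩
      rwa [Collapse.mk_eq_base (a := ⟨_, hp⟩) hB]

/-- For each of the finitely many `ι`, the labelled frame extracted by `ι` depends continuously on
the point, so its membership in the closed preimage of `Z` is a closed condition; basepoint labels
are closed conditions too, as `X` is Hausdorff. -/
theorem isQuotientMap_labelledToSubquotient [TopologicalSpace X] [CompactSpace X] [T2Space X] :
    IsQuotientMap (labelledToSubquotient U x₀ (s := s)) := by
  have : Nonempty X := ⟨x₀⟩
  refine isQuotientMap_iff_isClosed.2 ⟨labelledToSubquotient_surjective, fun Z =>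
    ⟨fun h => h.preimage continuous_labelledToSubquotient, fun h => ?_⟩⟩
  refine Collapse.isClosed_of_isClosed (isClosed_ku_of_isClosed fun k m => ?_)
  have hx : ∀ i : Fin k, Continuous fun p : IsoEmb (BlockSum m) U × BasedMap k X x₀ =>
      p.2.1 i.succ := fun i =>
    (continuous_apply _).comp (continuous_subtype_val.comp continuous_snd)
  have h₁ : IsClosed (⋃ ι : Fin s ↪ Σ i, Fin (m i),
      {p : IsoEmb (BlockSum m) U × BasedMap k X x₀ |
        (∀ a, a ∉ Set.range ι → p.2.1 a.1.succ = x₀) ∧ labelledToSubquotient U x₀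
          (fun j => p.2.1 (ι j).1.succ, Sum.inl (p.1.precomp (subFrame ι))) ∈ Z}) := by
    refine isClosed_iUnion_of_finite fun ι => ?_
    simp only [Set.ofPred_and, Set.ofPred_forall]
    refine (isClosed_iInter fun a => isClosed_iInter fun _ =>
      isClosed_eq (hx _) continuous_const).inter (h.preimage ?_)
    exact (continuous_pi fun j => hx _).prodMk
      (continuous_inl.comp ((IsoEmb.continuous_precomp _).comp continuous_fst))
  have h₂ : IsClosed (⋃ I : {I : Finset (Fin k) // ∑ i ∈ I, m i < s},
      {p : IsoEmb (BlockSum m) U × BasedMap k X x₀ |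
        (∀ i, i ∉ I.1 → p.2.1 i.succ = x₀) ∧ Collapse.base _ _ ∈ Z}) := by
    refine isClosed_iUnion_of_finite fun I => ?_
    simp only [Set.ofPred_and, Set.ofPred_forall]
    exact (isClosed_iInter fun a => isClosed_iInter fun _ =>
      isClosed_eq (hx _) continuous_const).inter isClosed_const
  convert h₁.union h₂ using 1
  ext p
  rw [Set.mem_union, Set.mem_iUnion, Set.mem_iUnion]
  exact exists_collapse_mk_mem_iff m p.1 p.2 Z

end RankQuotient

/-! ## The identifications of labelled frames -/

section Fibres

variable {n s : ℕ}

theorem mem_span_single_iff {Y : Type} (x : Fin s → Y) (y : Y) (w : EuclideanSpace ℂ (Fin s)) :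
    w ∈ Submodule.span ℂ {v | ∃ j, x j = y ∧ EuclideanSpace.single j (1 : ℂ) = v} ↔
      ∀ j, x j ≠ y → w j = 0 := by
  constructor
  · intro h j hj
    have : Submodule.span ℂ {v | ∃ j, x j = y ∧ EuclideanSpace.single j (1 : ℂ) = v} ≤
        LinearMap.ker (EuclideanSpace.proj j : EuclideanSpace ℂ (Fin s) →L[ℂ] ℂ).toLinearMap := by
      rw [Submodule.span_le]
      rintro _ ⟨l, hl, rfl⟩
      have : j ≠ l := fun e => hj (e ▸ hl)
      simp [this]
    exact this h
  · intro h
    have e : w = ∑ j, w j • EuclideanSpace.single j (1 : ℂ) := by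
      ext i
      simp [Pi.single_apply]
    rw [e]
    refine Submodule.sum_mem _ fun j _ => ?_
    by_cases hj : x j = y
    · exact Submodule.smul_mem _ _ (Submodule.subset_span ⟨j, hj, rfl⟩)
    · rw [h j hj, zero_smul]
      exact zero_mem _

/-- The joint eigenspace of a commuting tuple for the eigenvalues `√-1 y_i`. -/
noncomputable def CommVar.jointEigenspace (X : CommVar n s) (y : Fin n → ℝ) :
    Submodule ℂ (EuclideanSpace ℂ (Fin s)) :=
  ⨅ i, Module.End.eigenspace (Matrix.toEuclideanLin (X.1 i)) (Complex.I * y i)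

theorem CommVar.mem_jointEigenspace {X : CommVar n s} {y : Fin n → ℝ}
    {v : EuclideanSpace ℂ (Fin s)} : v ∈ X.jointEigenspace y ↔
      ∀ i, Matrix.toEuclideanLin (X.1 i) v = (Complex.I * y i) • v := by
  simp [CommVar.jointEigenspace]

theorem CommVar.jointEigenspace_diag (x : Fin s → Fin n → ℝ) (y : Fin n → ℝ) :
    (CommVar.diag x).jointEigenspace y =
      Submodule.span ℂ {v | ∃ j, x j = y ∧ EuclideanSpace.single j (1 : ℂ) = v} := by
  ext v
  rw [mem_span_single_iff, CommVar.mem_jointEigenspace]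
  have key : ∀ i j, Matrix.toEuclideanLin ((CommVar.diag x).1 i) v j = Complex.I * x j i * v j :=
    fun i j => Matrix.mulVec_diagonal (fun j => Complex.I * (x j i : ℂ)) v.ofLp j
  constructor
  · intro h j hj
    obtain ⟨i, hi⟩ := Function.ne_iff.1 hj
    have h1 := congrArg (fun w : EuclideanSpace ℂ (Fin s) => w j) (h i)
    simp only [key, PiLp.smul_apply, smul_eq_mul] at h1
    refine (mul_eq_mul_right_iff.1 h1).resolve_left fun h2 => hi ?_
    exact_mod_cast mul_left_cancel₀ Complex.I_ne_zero h2
  · intro h i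
    ext j
    rw [key, PiLp.smul_apply, smul_eq_mul]
    by_cases hj : x j = y
    · rw [hj]
    · rw [h j hj, mul_zero, mul_zero]

theorem CommVar.unitaryIso_mem_jointEigenspace {g : Matrix.unitaryGroup (Fin s) ℂ}
    {X : CommVar n s} {y : Fin n → ℝ} {v : EuclideanSpace ℂ (Fin s)}
    (hv : v ∈ X.jointEigenspace y) :
    unitaryIso g v ∈ (CommVar.conj g X).jointEigenspace y := by
  rw [CommVar.mem_jointEigenspace] at hv ⊢
  intro i
  have hg : (g⁻¹).1 * g.1 = 1 := by
    rw [← Submonoid.coe_mul, inv_mul_cancel, Submonoid.coe_one]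
  rw [← map_smul, ← hv i]
  change Matrix.toEuclideanLin (g.1 * X.1 i * (g⁻¹).1) (Matrix.toEuclideanLin g.1 v) =
    Matrix.toEuclideanLin g.1 (Matrix.toEuclideanLin (X.1 i) v)
  rw [← LinearMap.comp_apply, ← LinearMap.comp_apply, ← Matrix.toLpLin_mul, ← Matrix.toLpLin_mul,
    mul_assoc, hg, mul_one]

theorem unitaryIso_unitaryIso_inv (g : Matrix.unitaryGroup (Fin s) ℂ)
    (v : EuclideanSpace ℂ (Fin s)) : unitaryIso g (unitaryIso g⁻¹ v) = v := by
  have hg : g.1 * (g⁻¹).1 = 1 := by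
    rw [← Submonoid.coe_mul, mul_inv_cancel, Submonoid.coe_one]
  change Matrix.toEuclideanLin g.1 (Matrix.toEuclideanLin (g⁻¹).1 v) = v
  rw [← LinearMap.comp_apply, ← Matrix.toLpLin_mul, hg, Matrix.toLpLin_one]
  rfl

/-- This makes the images of the joint eigenspaces under the frame invariant under the balancing
relation, as `f(g E) = (f ∘ g)(E)`. -/
theorem CommVar.jointEigenspace_conj (g : Matrix.unitaryGroup (Fin s) ℂ) (X : CommVar n s)
    (y : Fin n → ℝ) : (CommVar.conj g X).jointEigenspace y =
      (X.jointEigenspace y).map (unitaryIso g).toLinearMap := by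
  apply le_antisymm
  · intro v hv
    refine ⟨unitaryIso g⁻¹ v, ?_, unitaryIso_unitaryIso_inv g v⟩
    have := CommVar.unitaryIso_mem_jointEigenspace (g := g⁻¹) hv
    rwa [CommVar.conj_inv_conj] at this
  · rintro _ ⟨v, hv, rfl⟩
    exact CommVar.unitaryIso_mem_jointEigenspace hv

/-- The images of the joint eigenspaces under the frame, for a point different from the
basepoint. -/
noncomputable def PreHalfSmash.parts (p : PreHalfSmash n s) :
    Option ((Fin n → ℝ) → Submodule ℂ (SymC n)) :=
  p.1.elim none fun X => Sum.elim (fun f => some fun y => (X.jointEigenspace y).map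
    (LinearIsometry.toLinearMap (σ₁₂ := RingHom.id ℂ) f)) (fun _ => none) p.2

theorem PreHalfSmash.parts_eq_none {p : PreHalfSmash n s}
    (h : p.1 = OnePoint.infty ∨ p.2 = Sum.inr ()) : PreHalfSmash.parts p = none := by
  obtain ⟨X, f⟩ := p
  obtain h | h := h <;> simp only at h <;> subst h
  · rfl
  · induction X using OnePoint.rec <;> rfl

/-- The images of the joint eigenspaces under the frame, for a point different from the
basepoint. -/
noncomputable def HalfSmash.parts (p : HalfSmash n s) :
    Option ((Fin n → ℝ) → Submodule ℂ (SymC n)) :=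
  Quot.lift PreHalfSmash.parts (by
    rintro _ _ (⟨p, q, hp, hq⟩ | ⟨g, X, f⟩)
    · rw [PreHalfSmash.parts_eq_none hp, PreHalfSmash.parts_eq_none hq]
    · induction X using OnePoint.rec with
      | infty => rfl
      | coe X =>
        refine congrArg some (funext fun y => ?_)
        rw [CommVar.jointEigenspace_conj]
        exact (Submodule.map_comp _ _ _).symm) p

theorem parts_labelledToHalfSmash (x : Fin s → Fin n → ℝ)
    (f : EuclideanSpace ℂ (Fin s) →ₗᵢ[ℂ] SymC n) :
    (labelledToHalfSmash (fun j => (x j : Sph n), Sum.inl f)).parts = some fun y =>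
      Submodule.span ℂ {v | ∃ j, x j = y ∧ f (EuclideanSpace.single j 1) = v} := by
  have h : labelledToHalfSmash (fun j => (x j : Sph n), Sum.inl f) =
      Quot.mk _ (((CommVar.diag x : CommVar n s) : OnePoint (CommVar n s)), Sum.inl f) := by
    rw [labelledToHalfSmash, CommVar.conjDiagPlus_coe, CommVar.conj_one]
    rfl
  rw [h]
  refine congrArg some (funext fun y => ?_)
  rw [CommVar.jointEigenspace_diag, Submodule.map_span]
  congr 1
  ext v
  constructor
  · rintro ⟨_, ⟨j, hj, rfl⟩, rfl⟩
    exact ⟨j, hj, rfl⟩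
  · rintro ⟨j, hj, rfl⟩
    exact ⟨_, ⟨j, hj, rfl⟩, rfl⟩

theorem labelledToHalfSmash_inl_eq_base_iff (x : Fin s → Sph n) (f : Frames n s) :
    labelledToHalfSmash (x, Sum.inl f) = HalfSmash.base n s ↔ ∃ j, x j = OnePoint.infty := by
  constructor
  · intro h
    by_contra! hx
    choose y hy using fun l => OnePoint.ne_infty_iff_exists.1 (hx l)
    obtain rfl : (fun j => (y j : Sph n)) = x := funext hy
    exact Option.some_ne_none _
      ((parts_labelledToHalfSmash y f).symm.trans (congrArg HalfSmash.parts h))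
  · intro h
    exact mk_eq_halfSmash_base (Or.inl (CommVar.conjDiagPlus_of_exists _ h))

/-- Two frames labelled by real points which span the same subspaces differ by a unitary matrix. -/
theorem exists_unitary_of_span_eq (x x' : Fin s → Fin n → ℝ)
    (f f' : EuclideanSpace ℂ (Fin s) →ₗᵢ[ℂ] SymC n)
    (h : ∀ y, Submodule.span ℂ {v | ∃ j, x j = y ∧ f (EuclideanSpace.single j 1) = v} =
      Submodule.span ℂ {v | ∃ j, x' j = y ∧ f' (EuclideanSpace.single j 1) = v}) :
    ∃ g : Matrix.unitaryGroup (Fin s) ℂ, f = f'.comp (unitaryIso g) ∧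
      CommVar.conj g (CommVar.diag x) = CommVar.diag x' := by
  -- The vector `w` gives the coordinates of `f(e_j)` in the frame `f'`; they are supported on the
  -- indices with the same label. These vectors become the columns of `g`.
  have h1 : ∀ j, ∃ w, (∀ l, x' l ≠ x j → w l = 0) ∧ f' w = f (EuclideanSpace.single j 1) := by
    intro j
    have h2 : f (EuclideanSpace.single j 1) ∈
        Submodule.span ℂ {v | ∃ l, x' l = x j ∧ f' (EuclideanSpace.single l 1) = v} := by
      rw [← h]
      exact Submodule.subset_span ⟨j, rfl, rfl⟩
    have h3 : {v | ∃ l, x' l = x j ∧ f' (EuclideanSpace.single l 1) = v} =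
        f'.toLinearMap '' {v | ∃ l, x' l = x j ∧ EuclideanSpace.single l (1 : ℂ) = v} := by
      ext v
      constructor
      · rintro ⟨l, hl, rfl⟩
        exact ⟨_, ⟨l, hl, rfl⟩, rfl⟩
      · rintro ⟨_, ⟨l, hl, rfl⟩, rfl⟩
        exact ⟨l, hl, rfl⟩
    rw [h3, ← Submodule.map_span] at h2
    obtain ⟨w, hw, hw'⟩ := h2
    exact ⟨w, (mem_span_single_iff x' (x j) w).1 hw, hw'⟩
  choose w hw hfw using h1
  let g₀ : Matrix (Fin s) (Fin s) ℂ := Matrix.of fun l j => w j l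
  have hg₀ : g₀ ∈ Matrix.unitaryGroup (Fin s) ℂ := by
    rw [Matrix.mem_unitaryGroup_iff']
    ext i j
    have h2 : inner ℂ (w i) (w j) = (1 : Matrix (Fin s) (Fin s) ℂ) i j := by
      rw [← f'.inner_map_map, hfw, hfw, f.inner_map_map]
      simp [Matrix.one_apply, PiLp.inner_apply, eq_comm]
    rw [← h2, PiLp.inner_apply, Matrix.mul_apply]
    refine Finset.sum_congr rfl fun l _ => ?_
    simp [g₀, Matrix.star_apply, mul_comm]
  let g : Matrix.unitaryGroup (Fin s) ℂ := ⟨g₀, hg₀⟩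
  have hgw : ∀ j, unitaryIso g (EuclideanSpace.single j 1) = w j := fun j => by
    rw [unitaryIso_single]
    ext i
    simp [g, g₀, Pi.single_apply]
  refine ⟨g, ?_, Subtype.ext (funext fun i => ?_)⟩
  · refine LinearIsometry.toLinearMap_injective
      ((EuclideanSpace.basisFun (Fin s) ℂ).toBasis.ext fun j => ?_)
    rw [OrthonormalBasis.coe_toBasis, EuclideanSpace.basisFun_apply]
    refine (hfw j).symm.trans ?_
    rw [← hgw j]
    rfl
  -- The entry of `g` at `(l, j)` vanishes unless `x' l = x j`, which is what intertwining the two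
  -- diagonal matrices requires.
  · have h2 : g.1 * (CommVar.diag x).1 i = (CommVar.diag x').1 i * g.1 := by
      ext l j
      rw [CommVar.diag, CommVar.diag, Matrix.mul_diagonal, Matrix.diagonal_mul]
      by_cases hl : x' l = x j
      · rw [hl, mul_comm]
      · have : g.1 l j = 0 := hw j l hl
        rw [this, zero_mul, mul_zero]
    have h3 : g.1 * (g⁻¹).1 = 1 := by
      rw [← Submonoid.coe_mul, mul_inv_cancel, Submonoid.coe_one]
    change g.1 * (CommVar.diag x).1 i * (g⁻¹).1 = _
    rw [h2, mul_assoc, h3, mul_one]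

/-- The invariant `HalfSmash.parts` reads the subspaces off the class; conversely, equal subspaces
yield a unitary matrix that realizes one balancing relation. -/
theorem labelledToHalfSmash_eq_iff (x x' : Fin s → Fin n → ℝ)
    (f f' : EuclideanSpace ℂ (Fin s) →ₗᵢ[ℂ] SymC n) :
    labelledToHalfSmash (fun j => (x j : Sph n), Sum.inl f) =
        labelledToHalfSmash (fun j => (x' j : Sph n), Sum.inl f') ↔
      ∀ y, Submodule.span ℂ {v | ∃ j, x j = y ∧ f (EuclideanSpace.single j 1) = v} =
        Submodule.span ℂ {v | ∃ j, x' j = y ∧ f' (EuclideanSpace.single j 1) = v} := by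
  constructor
  · intro h y
    have := congrArg HalfSmash.parts h
    rw [parts_labelledToHalfSmash, parts_labelledToHalfSmash, Option.some_inj] at this
    exact congrFun this y
  · intro h
    obtain ⟨g, rfl, hg⟩ := exists_unitary_of_span_eq x x' f f' h
    refine (mk_conjDiagPlus g (fun j => (x j : Sph n)) f').symm.trans ?_
    rw [CommVar.conjDiagPlus_coe, hg, labelledToHalfSmash, CommVar.conjDiagPlus_coe,
      CommVar.conj_one]

theorem labelledToSubquotient_inl_eq_base_iff (x : Fin s → Sph n) (f : Frames n s) :
    labelledToSubquotient (SymC n) OnePoint.infty (x, Sum.inl f) = Collapse.base _ _ ↔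
      ∃ j, x j = OnePoint.infty :=
  Collapse.mk_eq_base_iff.trans (mk_lineConfig_mem_iff x f)

theorem labelledToSubquotient_eq_iff (x x' : Fin s → Fin n → ℝ)
    (f f' : EuclideanSpace ℂ (Fin s) →ₗᵢ[ℂ] SymC n) :
    labelledToSubquotient (SymC n) (OnePoint.infty : Sph n)
          (fun j => (x j : Sph n), Sum.inl f) =
        labelledToSubquotient (SymC n) OnePoint.infty (fun j => (x' j : Sph n), Sum.inl f') ↔
      ∀ y, Submodule.span ℂ {v | ∃ j, x j = y ∧ f (EuclideanSpace.single j 1) = v} =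
        Submodule.span ℂ {v | ∃ j, x' j = y ∧ f' (EuclideanSpace.single j 1) = v} := by
  have key : ∀ (x : Fin s → Fin n → ℝ) (f : EuclideanSpace ℂ (Fin s) →ₗᵢ[ℂ] SymC n)
      (y : Fin n → ℝ), (lineConfig (OnePoint.infty : Sph n) (fun j => (x j : Sph n)) f).part y =
        Submodule.span ℂ {v | ∃ j, x j = y ∧ f (EuclideanSpace.single j 1) = v} := by
    intro x f y
    rw [part_lineConfig]
    simp only [OnePoint.coe_eq_coe]
  constructor
  · intro h y
    have h1 := Collapse.eq_of_mk_eq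
      (fun h' => by simpa using (mk_lineConfig_mem_iff _ f).1 h') h
    rw [← key, ← key]
    exact congrArg (fun p : KuSpace n => p.part ⟨(y : Sph n), OnePoint.coe_ne_infty y⟩) h1
  · intro h
    refine congrArg (Collapse.mk _ _) (Subtype.ext (KU.part_injective (funext fun ⟨y, hy⟩ => ?_)))
    obtain ⟨y, rfl⟩ := OnePoint.ne_infty_iff_exists.1 hy
    exact (key x f y).trans ((h y).trans (key x' f' y).symm)

/-- The two basepoint fibres agree; off them all labels are real and both equalities amount to the
same equality of spans. -/
theorem labelledToSubquotient_eq_iff_labelledToHalfSmash_eq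
    (t t' : (Fin s → Sph n) × (Frames n s ⊕ Unit)) :
    labelledToSubquotient (SymC n) OnePoint.infty t =
        labelledToSubquotient (SymC n) OnePoint.infty t' ↔
      labelledToHalfSmash t = labelledToHalfSmash t' := by
  have hbase : ∀ t : (Fin s → Sph n) × (Frames n s ⊕ Unit),
      labelledToSubquotient (SymC n) OnePoint.infty t = Collapse.base _ _ ↔
        labelledToHalfSmash t = HalfSmash.base n s := by
    rintro ⟨x, f | _⟩
    · rw [labelledToHalfSmash_inl_eq_base_iff]
      exact labelledToSubquotient_inl_eq_base_iff x f
    · exact iff_of_true rfl (mk_eq_halfSmash_base (Or.inr rfl))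
  by_cases ht : labelledToHalfSmash t = HalfSmash.base n s
  · rw [ht, (hbase t).2 ht, eq_comm, hbase, eq_comm]
  by_cases ht' : labelledToHalfSmash t' = HalfSmash.base n s
  · rw [ht', (hbase t').2 ht', hbase]
  have hform : ∀ t : (Fin s → Sph n) × (Frames n s ⊕ Unit),
      labelledToHalfSmash t ≠ HalfSmash.base n s →
      ∃ (x : Fin s → Fin n → ℝ) (f : Frames n s), t = (fun j => (x j : Sph n), Sum.inl f) := by
    rintro ⟨x, f | _⟩ h
    · rw [Ne, labelledToHalfSmash_inl_eq_base_iff] at h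
      push Not at h
      choose y hy using fun l => OnePoint.ne_infty_iff_exists.1 (h l)
      exact ⟨y, f, by rw [← funext hy]⟩
    · exact absurd (mk_eq_halfSmash_base (Or.inr rfl)) h
  obtain ⟨x, f, rfl⟩ := hform t ht
  obtain ⟨x', f', rfl⟩ := hform t' ht'
  exact (labelledToSubquotient_eq_iff x x' f f').trans (labelledToHalfSmash_eq_iff x x' f f').symm

end Fibres

/-! ## The homeomorphism -/

/-- Two quotient maps with the same fibres have homeomorphic targets. -/
theorem Topology.IsQuotientMap.exists_homeomorph {T A B : Type} [TopologicalSpace T]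
    [TopologicalSpace A] [TopologicalSpace B] {a : T → A} {b : T → B} (ha : IsQuotientMap a)
    (hb : IsQuotientMap b) (h : ∀ t t', a t = a t' ↔ b t = b t') :
    ∃ φ : A ≃ₜ B, ∀ t, φ (a t) = b t := by
  have h1 : ∀ t, b (Function.surjInv ha.surjective (a t)) = b t := fun t =>
    (h _ _).1 (Function.surjInv_eq _ _)
  have h2 : ∀ t, a (Function.surjInv hb.surjective (b t)) = a t := fun t =>
    (h _ _).2 (Function.surjInv_eq _ _)
  refine ⟨{ toFun := fun p => b (Function.surjInv ha.surjective p)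
            invFun := fun q => a (Function.surjInv hb.surjective q)
            left_inv := fun p => ?_
            right_inv := fun q => ?_
            continuous_toFun := ?_
            continuous_invFun := ?_ }, h1⟩
  · obtain ⟨t, rfl⟩ := ha.surjective p
    simp only [h2, Function.surjInv_eq]
  · obtain ⟨t, rfl⟩ := hb.surjective q
    simp only [h1, Function.surjInv_eq]
  · exact ha.continuous_iff.2 (hb.continuous.congr fun t => (h1 t).symm)
  · exact hb.continuous_iff.2 (ha.continuous.congr fun t => (h2 t).symm)

/-! ### Compatibility of both quotient maps with permutations. -/

section Equivariance

variable {n s : ℕ}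

/-- The action of a permutation on labelled frames. -/
noncomputable def labelledPerm (σ : Equiv.Perm (Fin n))
    (t : (Fin s → Sph n) × (Frames n s ⊕ Unit)) : (Fin s → Sph n) × (Frames n s ⊕ Unit) :=
  (fun j => Sph.perm σ (t.1 j), Sum.map (Frames.perm σ) id t.2)

theorem smul_labelledToHalfSmash (σ : Equiv.Perm (Fin n))
    (t : (Fin s → Sph n) × (Frames n s ⊕ Unit)) :
    σ • labelledToHalfSmash t = labelledToHalfSmash (labelledPerm σ t) := by
  obtain ⟨x, f⟩ := t
  refine congrArg (Quot.mk _) (Prod.ext ?_ rfl)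
  change OnePoint.map (CommVar.perm σ) (CommVar.conjDiagPlus 1 x) =
    CommVar.conjDiagPlus 1 fun j => Sph.perm σ (x j)
  by_cases h : ∃ j, x j = OnePoint.infty
  · rw [CommVar.conjDiagPlus_of_exists _ h, CommVar.conjDiagPlus_of_exists]
    · rfl
    · obtain ⟨j, hj⟩ := h
      exact ⟨j, (Sph.perm_eq_infty σ _).2 hj⟩
  · push Not at h
    choose y hy using fun l => OnePoint.ne_infty_iff_exists.1 (h l)
    obtain rfl : (fun j => (y j : Sph n)) = x := funext hy
    have e : (fun j => Sph.perm σ (y j : Sph n)) =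
        fun j => ((fun i => y j (σ⁻¹ i) : Fin n → ℝ) : Sph n) := rfl
    rw [e, CommVar.conjDiagPlus_coe, CommVar.conjDiagPlus_coe, CommVar.conj_one, CommVar.conj_one]
    rfl

theorem smul_labelledToSubquotient (σ : Equiv.Perm (Fin n))
    (t : (Fin s → Sph n) × (Frames n s ⊕ Unit)) :
    (σ • (labelledToSubquotient (SymC n) OnePoint.infty t : RankSubquotient n s) :
        RankSubquotient n s) =
      labelledToSubquotient (SymC n) OnePoint.infty (labelledPerm σ t) := by
  obtain ⟨x, f | _⟩ := t
  · refine congrArg (Collapse.mk _ _) (Subtype.ext (congrArg KU.mk ?_))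
    change preKuPerm σ (lineConfig OnePoint.infty x f) =
      lineConfig OnePoint.infty (fun j => Sph.perm σ (x j)) (Frames.perm σ f)
    refine Sigma.ext rfl (heq_of_eq (Prod.ext ?_ (Subtype.ext (funext fun i => ?_))))
    · ext1
      funext i
      exact (Submodule.map_comp _ _ _).symm
    · refine Fin.cases ?_ (fun j => ?_) i <;> rfl
  · rfl

end Equivariance

theorem theorem3p2 (n s : ℕ) (hn : 1 ≤ n) :
    ∃ φ : RankSubquotient n s ≃ₜ HalfSmash n s,
      φ (Collapse.base _ _) = HalfSmash.base n s ∧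
      ∀ (σ : Equiv.Perm (Fin n)) (p : RankSubquotient n s), φ (σ • p) = σ • φ p := by
  have ha : IsQuotientMap (labelledToSubquotient (SymC n) (OnePoint.infty : Sph n) (s := s)) :=
    isQuotientMap_labelledToSubquotient
  obtain ⟨φ, hφ⟩ := ha.exists_homeomorph isQuotientMap_labelledToHalfSmash
    labelledToSubquotient_eq_iff_labelledToHalfSmash_eq
  refine ⟨φ, ?_, fun σ p => ?_⟩
  · exact (hφ (fun _ => OnePoint.infty, Sum.inr ())).trans (mk_eq_halfSmash_base (Or.inr rfl))
  · obtain ⟨t, rfl⟩ := ha.surjective p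
    rw [hφ, smul_labelledToHalfSmash, ← hφ]
    exact congrArg φ (smul_labelledToSubquotient σ t)
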